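/- Let $(M,g)$ be a spacetime, i.e. a smooth ($C^\infty$) paracompact Hausdorff time-oriented Lorentzian manifold of dimension at least $2$ and signature $(-,+,\dots,+)$, with Levi-Civita connection $\nabla$. Let $H\subset M$ be a smooth horizon, i.e. a connected embedded null hypersurface which is totally geodesic: every smooth future-directed lightlike vector field $n$ tangent to $H$ satisfies $\nabla_X n=\omega(X)\,n$ for all $X$ tangent to $H$, for some 1-form $\omega$ on $H$; the function $\kappa=\omega(n)$ is the surface gravity of $n$. The generators of $H$ are the leaves of its lightlike line field, oriented by the future direction; a generator is complete if its affine (geodesic) parametrization is defined on all of $\mathbb R$. Suppose that $H$ is degenerate, i.e. that all its generators are complete, and that the generators are the (oriented) fibres of a smooth $S^1$-bundle $\pi\colon H\to B$ over a smooth manifold $B$. Then there is a smooth future-directed lightlike vector field $n$ tangent to $H$ with identically zero surface gravity. -/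

import Mathlib

open scoped Manifold ContDiff Bundle

namespace NullHorizon

noncomputable section

/-- A time-oriented Lorentzian metric of signature `(-,+,…,+)` on a smooth manifold of
dimension `d + 1`.  The time orientation is represented by a smooth timelike field. -/
structure Spacetime (d : ℕ) (M : Type*) [TopologicalSpace M]
    [ChartedSpace (EuclideanSpace ℝ (Fin (d + 1))) M] [IsManifold (𝓡 (d + 1)) ∞ M] where
  /-- the metric -/
  g : ∀ x : M, TangentSpace (𝓡 (d + 1)) x →L[ℝ] TangentSpace (𝓡 (d + 1)) x →L[ℝ] ℝ
  g_symm : ∀ x v w, g x v w = g x w v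
  /-- at every point there is a basis in which the metric is `diag(-1, 1, …, 1)` -/
  g_signature : ∀ x, ∃ b : Module.Basis (Fin (d + 1)) ℝ (TangentSpace (𝓡 (d + 1)) x),
    ∀ i j, g x (b i) (b j) = if i = j then (if i = 0 then -1 else 1) else 0
  g_smooth : ContMDiff (𝓡 (d + 1))
    ((𝓡 (d + 1)).prod 𝓘(ℝ, EuclideanSpace ℝ (Fin (d + 1)) →L[ℝ]
      EuclideanSpace ℝ (Fin (d + 1)) →L[ℝ] ℝ)) ∞
    (fun x => Bundle.TotalSpace.mk' (EuclideanSpace ℝ (Fin (d + 1)) →L[ℝ]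
      EuclideanSpace ℝ (Fin (d + 1)) →L[ℝ] ℝ) x (g x))
  /-- a timelike field declared to be future-directed -/
  time : ∀ x : M, TangentSpace (𝓡 (d + 1)) x
  time_timelike : ∀ x, g x (time x) (time x) < 0
  time_smooth : ContMDiff (𝓡 (d + 1)) (𝓡 (d + 1)).tangent ∞
    (fun x => (⟨x, time x⟩ : TangentBundle (𝓡 (d + 1)) M))

/-- Affine connections on a manifold of dimension `d`. -/
abbrev Connection (d : ℕ) (M : Type*) [TopologicalSpace M]
    [ChartedSpace (EuclideanSpace ℝ (Fin d)) M] [IsManifold (𝓡 d) ∞ M] :=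
  CovariantDerivative (𝓡 d) (EuclideanSpace ℝ (Fin d)) (TangentSpace (𝓡 d) : M → Type _)

/-- `D` is the Levi-Civita connection of the spacetime: smooth, torsion-free and metric.
Here `D σ x v` is `∇_v σ` at `x`. -/
structure IsLeviCivita {d : ℕ} {M : Type*} [TopologicalSpace M]
    [ChartedSpace (EuclideanSpace ℝ (Fin (d + 1))) M] [IsManifold (𝓡 (d + 1)) ∞ M]
    (S : Spacetime d M) (D : Connection (d + 1) M) : Prop where
  smooth : CovariantDerivative.ContMDiffCovariantDerivative D ∞
  torsion_free : D.torsion = 0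
  metric : ∀ (x : M) (v : TangentSpace (𝓡 (d + 1)) x)
    (σ τ : ∀ y : M, TangentSpace (𝓡 (d + 1)) y),
    MDifferentiableAt (𝓡 (d + 1)) (𝓡 (d + 1)).tangent
      (fun y => (⟨y, σ y⟩ : TangentBundle (𝓡 (d + 1)) M)) x →
    MDifferentiableAt (𝓡 (d + 1)) (𝓡 (d + 1)).tangent
      (fun y => (⟨y, τ y⟩ : TangentBundle (𝓡 (d + 1)) M)) x →
    (mfderiv (𝓡 (d + 1)) 𝓘(ℝ, ℝ) (fun y => S.g y (σ y) (τ y)) x v : ℝ) =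
      S.g x (D σ x v) (τ x) + S.g x (σ x) (D τ x v)

/-- The covariant derivative `∇_v V` at `p` of a vector field `V` along a map `f : N → M`
(for the pulled-back connection).  In the local frame `(E_i)` of `TM` given by the trivialization
`e` over the chart at `f p`, if `V = ∑ V^i (E_i ∘ f)`, it is
`∑ dV^i(v) E_i + ∇_{df(v)} (∑ V^i(p) E_i)`. -/
def covDerivAlong {d : ℕ} {M : Type*} [TopologicalSpace M]
    [ChartedSpace (EuclideanSpace ℝ (Fin d)) M] [IsManifold (𝓡 d) ∞ M] (D : Connection d M)
    {E' H' N : Type*} [NormedAddCommGroup E'] [NormedSpace ℝ E'] [TopologicalSpace H']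
    (J : ModelWithCorners ℝ E' H') [TopologicalSpace N] [ChartedSpace H' N]
    (f : N → M) (V : ∀ q : N, TangentSpace (𝓡 d) (f q)) (p : N) (v : TangentSpace J p) :
    TangentSpace (𝓡 d) (f p) :=
  let e := trivializationAt (EuclideanSpace ℝ (Fin d))
    (TangentSpace (𝓡 d) : M → Type _) (f p)
  let c : N → EuclideanSpace ℝ (Fin d) := fun q => (e ⟨f q, V q⟩).2
  e.symm (f p) (mfderiv J 𝓘(ℝ, EuclideanSpace ℝ (Fin d)) c p v)
    + D (fun x => e.symm x (c p)) (f p) (mfderiv J (𝓡 d) f p v)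

section Horizon

variable {d : ℕ} {M : Type*} [TopologicalSpace M]
  [ChartedSpace (EuclideanSpace ℝ (Fin (d + 1))) M] [IsManifold (𝓡 (d + 1)) ∞ M]
  {H : Type*} [TopologicalSpace H] [ChartedSpace (EuclideanSpace ℝ (Fin d)) H]
  [IsManifold (𝓡 d) ∞ H]

/-- The pulled-back form `g_T = ι^* g`. -/
def inducedForm (S : Spacetime d M) (ι : H → M) (p : H) (v w : TangentSpace (𝓡 d) p) : ℝ :=
  S.g (ι p) (mfderiv (𝓡 d) (𝓡 (d + 1)) ι p v) (mfderiv (𝓡 d) (𝓡 (d + 1)) ι p w)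

/-- `n` is a smooth future-directed lightlike field tangent to `H`. -/
structure IsLightlikeField (S : Spacetime d M) (ι : H → M)
    (n : ∀ p : H, TangentSpace (𝓡 d) p) : Prop where
  smooth : ContMDiff (𝓡 d) (𝓡 d).tangent ∞ (fun p => (⟨p, n p⟩ : TangentBundle (𝓡 d) H))
  lightlike : ∀ p, inducedForm S ι p (n p) (n p) = 0
  future : ∀ p, S.g (ι p) (S.time (ι p)) (mfderiv (𝓡 d) (𝓡 (d + 1)) ι p (n p)) < 0

/-- `∇_X n = θ(X) n` for all `X` tangent to `H`. -/
def IsRotationForm (D : Connection (d + 1) M) (ι : H → M)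
    (n : ∀ p : H, TangentSpace (𝓡 d) p) (θ : ∀ p : H, TangentSpace (𝓡 d) p →L[ℝ] ℝ) : Prop :=
  ∀ (p : H) (v : TangentSpace (𝓡 d) p),
    covDerivAlong D (𝓡 d) ι (fun q => mfderiv (𝓡 d) (𝓡 (d + 1)) ι q (n q)) p v
      = θ p v • mfderiv (𝓡 d) (𝓡 (d + 1)) ι p (n p)

/-- `κ` is the surface gravity `θ(n)` of `n`, where `∇_X n = θ(X) n`. -/
def HasSurfaceGravity (D : Connection (d + 1) M) (ι : H → M)
    (n : ∀ p : H, TangentSpace (𝓡 d) p) (κ : H → ℝ) : Prop :=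
  ∃ θ : ∀ p : H, TangentSpace (𝓡 d) p →L[ℝ] ℝ, IsRotationForm D ι n θ ∧ ∀ p, κ p = θ p (n p)

/-- `ι` embeds `H` as a horizon: a connected totally geodesic null hypersurface.  Total geodesy
of a null hypersurface is the property `∇_X n = θ(X) n` of its lightlike tangent fields `n`
(such fields exist, by the time orientation). -/
structure IsHorizon (S : Spacetime d M) (D : Connection (d + 1) M) (ι : H → M) : Prop where
  connected : ConnectedSpace H
  embedding : Manifold.IsSmoothEmbedding (𝓡 d) (𝓡 (d + 1)) ∞ ι
  null : ∀ p : H, ∃ v : TangentSpace (𝓡 d) p, v ≠ 0 ∧ ∀ w, inducedForm S ι p v w = 0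
  totally_geodesic : ∀ n : (∀ p : H, TangentSpace (𝓡 d) p), IsLightlikeField S ι n →
    ∃ θ : ∀ p : H, TangentSpace (𝓡 d) p →L[ℝ] ℝ, IsRotationForm D ι n θ

/-- A regular smooth curve in `H` with lightlike velocity, defined on all of `ℝ`. -/
structure IsLightlikeCurve (S : Spacetime d M) (ι : H → M) (γ : ℝ → H) : Prop where
  smooth : ContMDiff 𝓘(ℝ, ℝ) (𝓡 d) ∞ γ
  regular : ∀ t, mfderiv 𝓘(ℝ, ℝ) (𝓡 d) γ t (1 : ℝ) ≠ 0
  lightlike : ∀ t, inducedForm S ι (γ t) (mfderiv 𝓘(ℝ, ℝ) (𝓡 d) γ t (1 : ℝ))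
    (mfderiv 𝓘(ℝ, ℝ) (𝓡 d) γ t (1 : ℝ)) = 0

/-- A generator (as an unparametrized curve): a leaf of the lightlike line field of `H`, that is,
the image of a lightlike curve which contains every lightlike curve that meets it. -/
def IsGenerator (S : Spacetime d M) (ι : H → M) (L : Set H) : Prop :=
  (∃ γ : ℝ → H, IsLightlikeCurve S ι γ ∧ Set.range γ = L) ∧
    ∀ δ : ℝ → H, IsLightlikeCurve S ι δ → (Set.range δ ∩ L).Nonempty → Set.range δ ⊆ L

/-- The generator `L` is complete: its affine (geodesic) parametrization is defined on all
of `ℝ`. -/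
def IsCompleteGenerator (S : Spacetime d M) (D : Connection (d + 1) M) (ι : H → M)
    (L : Set H) : Prop :=
  ∃ γ : ℝ → H, IsLightlikeCurve S ι γ ∧ Set.range γ = L ∧
    ∀ t : ℝ, covDerivAlong D 𝓘(ℝ, ℝ) (ι ∘ γ)
      (fun s => mfderiv 𝓘(ℝ, ℝ) (𝓡 (d + 1)) (ι ∘ γ) s (1 : ℝ)) t (1 : ℝ) = 0

/-- The horizon is degenerate: all its generators are complete. -/
def IsDegenerate (S : Spacetime d M) (D : Connection (d + 1) M) (ι : H → M) : Prop :=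
  ∀ L : Set H, IsGenerator S ι L → IsCompleteGenerator S D ι L

end Horizon

/-- `proj : H → B` is a smooth fibre bundle with fibre the circle. -/
def IsSmoothCircleBundle {d k : ℕ} {H B : Type*} [TopologicalSpace H]
    [ChartedSpace (EuclideanSpace ℝ (Fin d)) H] [TopologicalSpace B]
    [ChartedSpace (EuclideanSpace ℝ (Fin k)) B] (proj : H → B) : Prop :=
  ∀ b : B, ∃ e : Bundle.Trivialization Circle proj, b ∈ e.baseSet ∧
    ContMDiffOn (𝓡 d) ((𝓡 k).prod (𝓡 1)) ∞ e e.source ∧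
    ContMDiffOn ((𝓡 k).prod (𝓡 1)) (𝓡 d) ∞ e.toOpenPartialHomeomorph.symm e.target

end

end NullHorizon

/-! Let `T` be the time field and `X` the lightlike field tangent to the fibres with `g(X, T) = -1`;
it is global, smooth and future-directed. Put `σ(v) = g(v, ∇_v T)`. For `n = F X` with `F > 0`,
pairing `∇_n n = θ(n) n` with `T` and using metricity gives `θ(n) = X F + σ(X) F`. A field with zero
surface gravity is thus a positive solution of the linear equation `X F = -σ(X) F` along the fibres.

On one circle the equation is solvable exactly when its holonomy is trivial. For a vertical field
`V` generating rotations this says that `κ = -σ(V) / g(V, T)` has zero integral over a period.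
Completeness forces this (`integral_period_eq_zero_of_complete`): with nontrivial holonomy, going
once around acts on the affine parameter as an affine map of ratio different from 1. Such a map has
a fixed point, yet the developed parameter is strictly monotone and takes every real value.

With trivial holonomy, an integral over the fibre gives smooth positive solutions over each
trivialization (`IsSmoothTrivialization.exists_scaling`). The equation is linear and differentiates
only along fibres, so a partition of unity pulled back from `B` glues them
(`exists_global_scaling`). -/

namespace NullHorizon

/-! ### Smooth dependence of integrals on parameters -/

section ParametricIntegral

universe u

variable {E G : Type u} [NormedAddCommGroup E] [NormedSpace ℝ E] [FiniteDimensional ℝ E]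
  [NormedAddCommGroup G] [NormedSpace ℝ G]

theorem hasFDerivAt_parametric_integral {f : E × ℝ → G} {V : Set E} (hV : IsOpen V)
    (hf : ContDiffOn ℝ ∞ f (V ×ˢ Set.univ)) (a b : ℝ) {x₀ : E} (hx₀ : x₀ ∈ V) :
    HasFDerivAt (fun x => ∫ u in a..b, f (x, u))
      (∫ u in a..b, (fderiv ℝ f (x₀, u)).comp (ContinuousLinearMap.inl ℝ E ℝ)) x₀ := by
  have hW : IsOpen (V ×ˢ (Set.univ : Set ℝ)) := hV.prod isOpen_univ
  have hf' : ContinuousOn (fun z => (fderiv ℝ f z).comp (ContinuousLinearMap.inl ℝ E ℝ))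
      (V ×ˢ Set.univ) :=
    ((hf.continuousOn_fderiv_of_isOpen hW (by simp)).clm_comp continuousOn_const)
  -- A closed ball in finite dimension times the integration interval is compact, so a constant
  -- dominates the partial derivative.
  obtain ⟨r, hr, hrV⟩ := Metric.nhds_basis_closedBall.mem_iff.1 (hV.mem_nhds hx₀)
  have hcomp : IsCompact (Metric.closedBall x₀ r ×ˢ Set.uIcc a b) := by
    have := FiniteDimensional.proper_real E
    exact (isCompact_closedBall x₀ r).prod isCompact_uIcc
  obtain ⟨C, hC⟩ := hcomp.exists_bound_of_continuousOn
    (hf'.mono (Set.prod_mono hrV (Set.subset_univ _)))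
  have hcont : ∀ x ∈ V, Continuous fun u : ℝ => f (x, u) := fun x hx =>
    hf.continuousOn.comp_continuous (by fun_prop) (fun u => ⟨hx, Set.mem_univ _⟩)
  have hcont' : Continuous fun u : ℝ =>
      (fderiv ℝ f (x₀, u)).comp (ContinuousLinearMap.inl ℝ E ℝ) :=
    hf'.comp_continuous (f := fun u : ℝ => (x₀, u)) (by fun_prop)
      (fun u => ⟨hx₀, Set.mem_univ _⟩)
  refine intervalIntegral.hasFDerivAt_integral_of_dominated_of_fderiv_le
    (F' := fun x u => (fderiv ℝ f (x, u)).comp (ContinuousLinearMap.inl ℝ E ℝ))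
    (bound := fun _ => C) (Metric.closedBall_mem_nhds x₀ hr) ?_ ?_ ?_ ?_ ?_ ?_
  · filter_upwards [hV.mem_nhds hx₀] with x hx
    exact (hcont x hx).aestronglyMeasurable
  · exact (hcont x₀ hx₀).intervalIntegrable _ _
  · exact hcont'.aestronglyMeasurable
  · refine Filter.Eventually.of_forall fun t ht x hx => hC (x, t) ⟨hx, ?_⟩
    exact Set.uIoc_subset_uIcc ht
  · exact intervalIntegrable_const
  · refine Filter.Eventually.of_forall fun t ht x hx => ?_
    have h1 : HasFDerivAt f (fderiv ℝ f (x, t)) (x, t) :=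
      ((hf.contDiffAt (hW.mem_nhds ⟨hrV hx, Set.mem_univ _⟩)).differentiableAt
        (by simp)).hasFDerivAt
    exact h1.comp x (hasFDerivAt_prodMk_left x t)

/-- The derivative is again a parametric integral, now with values in `E →L[ℝ] G`. The induction
therefore runs over all codomains, and `E` and `G` share a universe so that this space is among
them. -/
theorem contDiffOn_parametric_integral_nat (n : ℕ) : ∀ {G : Type u} [NormedAddCommGroup G]
    [NormedSpace ℝ G] {f : E × ℝ → G} {V : Set E} (_ : IsOpen V)
    (_ : ContDiffOn ℝ ∞ f (V ×ˢ Set.univ)) (a b : ℝ),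
    ContDiffOn ℝ n (fun x => ∫ u in a..b, f (x, u)) V := by
  induction n with
  | zero =>
    intro G _ _ f V hV hf a b
    refine contDiffOn_zero.2 fun x hx => ?_
    exact (hasFDerivAt_parametric_integral hV hf a b hx).continuousAt.continuousWithinAt
  | succ n ih =>
    intro G _ _ f V hV hf a b
    have hW : IsOpen (V ×ˢ (Set.univ : Set ℝ)) := hV.prod isOpen_univ
    have : ((n + 1 : ℕ) : ℕ∞ω) = (n : ℕ∞ω) + 1 := by push_cast; rfl
    rw [this, contDiffOn_succ_iff_fderiv_of_isOpen hV]
    refine ⟨fun x hx => (hasFDerivAt_parametric_integral hV hf a b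
      hx).differentiableAt.differentiableWithinAt, by simp, ?_⟩
    have h2 : ContDiffOn ℝ ∞ (fun z => (fderiv ℝ f z).comp (ContinuousLinearMap.inl ℝ E ℝ))
        (V ×ˢ Set.univ) :=
      (hf.fderiv_of_isOpen hW (by simp)).clm_comp contDiffOn_const
    exact (ih hV h2 a b).congr fun x hx => (hasFDerivAt_parametric_integral hV hf a b hx).fderiv

theorem contDiffOn_parametric_integral {f : E × ℝ → G} {V : Set E} (hV : IsOpen V)
    (hf : ContDiffOn ℝ ∞ f (V ×ˢ Set.univ)) (a b : ℝ) :
    ContDiffOn ℝ ∞ (fun x => ∫ u in a..b, f (x, u)) V :=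
  contDiffOn_infty.2 fun n => contDiffOn_parametric_integral_nat n hV hf a b

theorem contMDiffOn_parametric_integral {H N : Type*} [TopologicalSpace H]
    (I : ModelWithCorners ℝ E H) [I.Boundaryless]
    [TopologicalSpace N] [ChartedSpace H N] [IsManifold I ∞ N]
    {f : N × ℝ → G} {W : Set N} (hW : IsOpen W)
    (hf : ContMDiffOn (I.prod 𝓘(ℝ, ℝ)) 𝓘(ℝ, G) ∞ f (W ×ˢ Set.univ)) (a b : ℝ) :
    ContMDiffOn I 𝓘(ℝ, G) ∞ (fun x => ∫ u in a..b, f (x, u)) W := by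
  intro x hx
  apply ContMDiffAt.contMDiffWithinAt
  set φ := extChartAt I x with hφ
  set V : Set E := φ.target ∩ φ.symm ⁻¹' W with hVdef
  have hV : IsOpen V := (continuousOn_extChartAt_symm x).isOpen_inter_preimage
    (isOpen_extChartAt_target x) hW
  have hsymm : ContMDiffOn 𝓘(ℝ, E) I ∞ φ.symm V :=
    (contMDiffOn_extChartAt_symm x).mono Set.inter_subset_left
  have h1 : ContDiffOn ℝ ∞ (fun z : E × ℝ => f (φ.symm z.1, z.2)) (V ×ˢ Set.univ) := by
    rw [← contMDiffOn_iff_contDiffOn]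
    refine hf.comp (I' := I.prod 𝓘(ℝ, ℝ)) (g := f) (f := fun z : E × ℝ => (φ.symm z.1, z.2))
      ((hsymm.comp (contDiff_fst.contMDiff (n := ∞)).contMDiffOn (fun z hz => hz.1)).prodMk
        (contDiff_snd.contMDiff (n := ∞)).contMDiffOn) ?_
    rintro ⟨z, u⟩ ⟨hz, -⟩
    exact ⟨hz.2, Set.mem_univ _⟩
  have h2 := contDiffOn_parametric_integral hV h1 a b
  have hxV : φ x ∈ V := ⟨mem_extChartAt_target x, by
    simpa [hφ, extChartAt_to_inv] using hx⟩
  have h3 : ContMDiffAt 𝓘(ℝ, E) 𝓘(ℝ, G) ∞ (fun x => ∫ u in a..b, f (φ.symm x, u)) (φ x) :=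
    (h2.contDiffAt (hV.mem_nhds hxV)).contMDiffAt
  have h4 := h3.comp x (contMDiffAt_extChartAt (I := I) (n := ∞) (x := x))
  refine h4.congr_of_eventuallyEq ?_
  filter_upwards [extChartAt_source_mem_nhds (I := I) x] with y hy
  simp only [Function.comp]
  rw [hφ, (extChartAt I x).left_inv hy]

end ParametricIntegral

/-! ### Holonomy of a complete periodic geodesic, and lifts of curves in the circle -/

section Holonomy

/-- If `s` traces an affinely parametrized complete geodesic of a periodic line, then the
logarithmic holonomy `∫ k` over a period vanishes: otherwise the affine coordinate `Φ` would satisfy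
`Φ (x + T) = Φ T + q * Φ x` with `q ≠ 1`, and the fixed point of the affine map on the right,
attained by completeness, would contradict the injectivity of `Φ`. -/
theorem integral_period_eq_zero_of_complete {T : ℝ} (hT : 0 < T) {k τ s w : ℝ → ℝ}
    (hk : Continuous k) (hkp : Function.Periodic k T)
    (hτ : Continuous τ) (hτp : Function.Periodic τ T) (hτ0 : ∀ x, τ x ≠ 0)
    (hs : ∀ t, HasDerivAt s (w t) t) (hw : ∀ t, w t ≠ 0)
    (hy : ∀ t, HasDerivAt (fun t => w t * τ (s t))
      (-(w t * k (s t)) * (w t * τ (s t))) t) :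
    ∫ u in (0 : ℝ)..T, k u = 0 := by
  set I := ∫ u in (0 : ℝ)..T, k u with hI
  set K : ℝ → ℝ := fun x => ∫ u in (0 : ℝ)..x, k u with hK
  have hKd : ∀ x, HasDerivAt K (k x) x := fun x =>
    intervalIntegral.integral_hasDerivAt_right (hk.intervalIntegrable _ _)
      hk.stronglyMeasurable.stronglyMeasurableAtFilter hk.continuousAt
  have hKc : Continuous K := continuous_iff_continuousAt.2 fun x => (hKd x).continuousAt
  have hKT : ∀ x, K (x + T) = K x + I := fun x => by
    have := hkp.intervalIntegral_add_eq_add 0 x (fun a b => hk.intervalIntegrable a b)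
    simpa [hK, hI] using this
  have hφc : Continuous fun u => Real.exp (K u) * τ u := (Real.continuous_exp.comp hKc).mul hτ
  set Φ : ℝ → ℝ := fun x => ∫ u in (0 : ℝ)..x, Real.exp (K u) * τ u with hΦ
  have hΦd : ∀ x, HasDerivAt Φ (Real.exp (K x) * τ x) x := fun x =>
    intervalIntegral.integral_hasDerivAt_right (hφc.intervalIntegrable _ _)
      hφc.stronglyMeasurable.stronglyMeasurableAtFilter hφc.continuousAt
  have hΦ0 : Φ 0 = 0 := by simp [hΦ]
  -- Rolle's theorem, since the derivative `exp K * τ` never vanishes.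
  have hΦinj : ∀ x, Φ (x + T) ≠ Φ x := by
    intro x hx
    obtain ⟨c, -, hc⟩ := exists_hasDerivAt_eq_zero (f := Φ) (a := x) (b := x + T) (by linarith)
      (fun y _ => (hΦd y).continuousAt.continuousWithinAt) hx.symm (fun y _ => hΦd y)
    exact mul_ne_zero (Real.exp_pos _).ne' (hτ0 c) hc
  have hΦT : ∀ x, Φ (x + T) = Φ T + Real.exp I * Φ x := by
    have hd : ∀ x, HasDerivAt (fun x => Φ (x + T) - Real.exp I * Φ x) 0 x := fun x => by
      have h1 := ((hΦd (x + T)).comp_add_const x T).sub ((hΦd x).const_mul (Real.exp I))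
      refine h1.congr_deriv ?_
      rw [hKT, hτp x, Real.exp_add]; ring
    intro x
    have := is_const_of_deriv_eq_zero (fun x => (hd x).differentiableAt)
      (fun x => (hd x).deriv) x 0
    simp only [zero_add, hΦ0, mul_zero, sub_zero] at this
    linarith
  -- in the affine parameter the geodesic is traversed at constant speed
  have hCd : ∀ t, HasDerivAt (fun t => Real.exp (K (s t)) * (w t * τ (s t))) 0 t := fun t => by
    have h1 := (((hKd (s t)).comp t (hs t)).exp).mul (hy t)
    refine h1.congr_deriv ?_
    simp only [Function.comp_apply]; ring
  set C := Real.exp (K (s 0)) * (w 0 * τ (s 0)) with hC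
  have hC0 : C ≠ 0 := mul_ne_zero (Real.exp_pos _).ne' (mul_ne_zero (hw 0) (hτ0 _))
  have hCc : ∀ t, Real.exp (K (s t)) * (w t * τ (s t)) = C := fun t =>
    is_const_of_deriv_eq_zero (fun x => (hCd x).differentiableAt) (fun x => (hCd x).deriv) t 0
  have hΦs : ∀ t, Φ (s t) = C * t + Φ (s 0) := by
    have hd : ∀ t, HasDerivAt (fun t => Φ (s t) - C * t) 0 t := fun t => by
      have h1 := ((hΦd (s t)).comp t (hs t)).sub ((hasDerivAt_id t).const_mul C)
      refine h1.congr_deriv ?_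
      rw [← hCc t]; ring
    intro t
    have := is_const_of_deriv_eq_zero (fun x => (hd x).differentiableAt)
      (fun x => (hd x).deriv) t 0
    simp only [mul_zero, sub_zero] at this
    linarith
  by_contra hI0
  have hq : 1 - Real.exp I ≠ 0 := by
    intro h
    exact hI0 (Real.exp_eq_one_iff I |>.1 (by linarith))
  set x' := Φ T / (1 - Real.exp I) with hx'
  have hfix : Φ T + Real.exp I * x' = x' := by rw [hx']; field_simp; ring
  -- Completeness enters here: `Φ ∘ s` is affine with slope `C ≠ 0` on all of `ℝ`, so it attains the
  -- fixed point.
  have hat : Φ (s ((x' - Φ (s 0)) / C)) = x' := by rw [hΦs]; field_simp; ring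
  exact hΦinj _ (by rw [hΦT, hat, hfix])

/-- As `|z| = 1`, the product of `z'` with the conjugate of `z` is purely imaginary, equal to `w *
I`. Integrating `w` from the initial argument gives the angle: the conjugate of `z` times `exp (s *
I)` has zero derivative. -/
theorem exists_lift_circle {c : ℝ → Circle} (hc : ContMDiff 𝓘(ℝ, ℝ) (𝓡 1) ∞ c) :
    ∃ s w : ℝ → ℝ, (∀ t, HasDerivAt s (w t) t) ∧ ∀ t, Circle.exp (s t) = c t := by
  set z : ℝ → ℂ := fun t => (c t : ℂ) with hz
  have hzc : ContDiff ℝ ∞ z := by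
    rw [← contMDiff_iff_contDiff]
    have : Fact (Module.finrank ℝ ℂ = 1 + 1) := ⟨Complex.finrank_real_complex⟩
    exact (contMDiff_coe_sphere (E := ℂ) (n := 1)).comp hc
  have hzd : ∀ t, HasDerivAt z (deriv z t) t := fun t =>
    (hzc.differentiable (by simp) t).hasDerivAt
  have hz' : Continuous (deriv z) := hzc.continuous_deriv (by simp)
  have hn : ∀ t, z t * (starRingEnd ℂ) (z t) = 1 := fun t => by
    rw [Complex.mul_conj, Complex.normSq_eq_norm_sq, hz]; simp [Circle.norm_coe]
  set w : ℝ → ℝ := fun t => (deriv z t * (starRingEnd ℂ) (z t)).im with hw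
  have hwc : Continuous w := by
    have := hzc.continuous
    exact Complex.continuous_im.comp (hz'.mul (Complex.continuous_conj.comp this))
  have hwz : ∀ t, deriv z t * (starRingEnd ℂ) (z t) = w t * Complex.I := fun t => by
    have h1 : HasDerivAt (fun t => z t * (starRingEnd ℂ) (z t))
        (deriv z t * (starRingEnd ℂ) (z t) + z t * (starRingEnd ℂ) (deriv z t)) t :=
      (hzd t).mul ((Complex.conjCLE.toContinuousLinearMap.hasFDerivAt
        (x := z t)).comp_hasDerivAt t (hzd t))
    have h2 : HasDerivAt (fun t => z t * (starRingEnd ℂ) (z t)) 0 t := by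
      simp only [hn]; exact hasDerivAt_const t 1
    have h3 := congrArg Complex.re (h1.unique h2)
    apply Complex.ext
    · simp at h3 ⊢; linarith
    · simp [hw]
  set s : ℝ → ℝ := fun t => Complex.arg (z 0) + ∫ u in (0 : ℝ)..t, w u with hs
  have hsd : ∀ t, HasDerivAt s (w t) t := fun t =>
    (intervalIntegral.integral_hasDerivAt_right (hwc.intervalIntegrable _ _)
      hwc.stronglyMeasurable.stronglyMeasurableAtFilter hwc.continuousAt).const_add _
  refine ⟨s, w, hsd, fun t => ?_⟩
  have hd : ∀ t, HasDerivAt (fun t => (starRingEnd ℂ) (z t) * Complex.exp (s t * Complex.I)) 0 t :=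
      fun t => by
    have h1 := ((Complex.conjCLE.toContinuousLinearMap.hasFDerivAt
        (x := z t)).comp_hasDerivAt t (hzd t)).mul
      ((((hsd t).ofReal_comp).mul_const Complex.I).cexp)
    refine h1.congr_deriv ?_
    have h4 := congrArg (starRingEnd ℂ) (hwz t)
    simp only [map_mul, Complex.conj_conj, Complex.conj_ofReal, Complex.conj_I] at h4
    have h5 : (starRingEnd ℂ) (deriv z t) = -(w t * Complex.I) * (starRingEnd ℂ) (z t) := by
      calc (starRingEnd ℂ) (deriv z t)
          = (starRingEnd ℂ) (deriv z t) * (z t * (starRingEnd ℂ) (z t)) := by rw [hn, mul_one]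
        _ = ((starRingEnd ℂ) (deriv z t) * z t) * (starRingEnd ℂ) (z t) := by ring
        _ = _ := by rw [h4]; ring
    simp [h5]
    ring
  have hconst := is_const_of_deriv_eq_zero (fun x => (hd x).differentiableAt)
    (fun x => (hd x).deriv) t 0
  have h0 : Complex.exp (s 0 * Complex.I) = z 0 := by
    have := congrArg (fun c : Circle => (c : ℂ)) (Circle.exp_arg (c 0))
    simpa only [hs, hz, Circle.coe_exp, intervalIntegral.integral_same, add_zero] using this
  rw [h0, mul_comm _ (z 0), hn] at hconst
  ext
  rw [Circle.coe_exp]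
  calc Complex.exp (s t * Complex.I)
      = z t * ((starRingEnd ℂ) (z t) * Complex.exp (s t * Complex.I)) := by
        rw [← mul_assoc, hn, one_mul]
    _ = _ := by rw [hconst, mul_one]

end Holonomy

/-! ### Timelike and lightlike vectors -/

section Lorentz

/-- If the pairing vanished, Cauchy–Schwarz for the spatial parts would give `t0² v0² ≤ |x|² v0²`.
But `|x|² < t0²`, so `v0 = 0`, and then the lightlike `v` is zero. -/
theorem pairing_ne_zero_of_timelike_of_lightlike {d : ℕ} {V : Type*} [AddCommGroup V] [Module ℝ V]
    [TopologicalSpace V] (B : V →L[ℝ] V →L[ℝ] ℝ) (b : Module.Basis (Fin (d + 1)) ℝ V)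
    (hb : ∀ i j, B (b i) (b j) = if i = j then (if i = 0 then -1 else 1) else 0)
    {t v : V} (ht : B t t < 0) (hv : B v v = 0) (hv0 : v ≠ 0) : B t v ≠ 0 := by
  have key : ∀ x y : V, B x y =
      - (b.repr x 0 * b.repr y 0) + ∑ i : Fin d, b.repr x i.succ * b.repr y i.succ := by
    intro x y
    conv_lhs => rw [← b.sum_repr x, ← b.sum_repr y]
    simp only [map_sum, map_smul, sum_apply, smul_apply, hb, smul_eq_mul]
    simp [Fin.sum_univ_succ, Fin.succ_ne_zero, mul_comm]
  intro h
  rw [key] at ht hv h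
  set x : Fin d → ℝ := fun i => b.repr t i.succ with hx
  set y : Fin d → ℝ := fun i => b.repr v i.succ with hy
  have cs := Finset.sum_mul_sq_le_sq_mul_sq Finset.univ x y
  have hy0 : 0 ≤ ∑ i, y i * y i := Finset.sum_nonneg fun i _ => mul_self_nonneg _
  have hx0 : 0 ≤ ∑ i, x i * x i := Finset.sum_nonneg fun i _ => mul_self_nonneg _
  have e1 : ∑ i, x i ^ 2 = ∑ i, x i * x i := by simp [sq]
  have e2 : ∑ i, y i ^ 2 = ∑ i, y i * y i := by simp [sq]
  rw [e1, e2] at cs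
  set t0 := b.repr t 0
  set v0 := b.repr v 0
  have hv1 : ∑ i, y i * y i = v0 * v0 := by linarith
  have h1 : ∑ i, x i * y i = t0 * v0 := by linarith
  rw [hv1, h1] at cs
  have hv00 : v0 = 0 := by
    by_contra hne
    have : 0 < v0 * v0 := mul_self_pos.2 hne
    nlinarith
  rw [hv00, mul_zero] at hv1
  apply hv0
  rw [← b.repr.map_eq_zero_iff]
  ext i
  refine Fin.cases hv00 (fun j => ?_) i
  have := (Finset.sum_eq_zero_iff_of_nonneg (fun i _ => mul_self_nonneg (y i))).1 hv1 j
    (Finset.mem_univ _)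
  exact mul_self_eq_zero.1 this

end Lorentz

/-! ### The metric and its connection along maps -/

section Along

variable {d : ℕ} {M : Type*} [TopologicalSpace M]
  [ChartedSpace (EuclideanSpace ℝ (Fin (d + 1))) M] [IsManifold (𝓡 (d + 1)) ∞ M]
  {E' H' N : Type*} [NormedAddCommGroup E'] [NormedSpace ℝ E'] [TopologicalSpace H']
  {J : ModelWithCorners ℝ E' H'} [TopologicalSpace N] [ChartedSpace H' N]

theorem Spacetime.contMDiffWithinAt_metric (S : Spacetime d M) {f : N → M} {s : Set N} {p : N}
    {V W : ∀ q : N, TangentSpace (𝓡 (d + 1)) (f q)}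
    (hV : ContMDiffWithinAt J (𝓡 (d + 1)).tangent ∞
      (fun q => (⟨f q, V q⟩ : TangentBundle (𝓡 (d + 1)) M)) s p)
    (hW : ContMDiffWithinAt J (𝓡 (d + 1)).tangent ∞
      (fun q => (⟨f q, W q⟩ : TangentBundle (𝓡 (d + 1)) M)) s p) :
    ContMDiffWithinAt J 𝓘(ℝ, ℝ) ∞ (fun q => S.g (f q) (V q) (W q)) s p := by
  have hf : ContMDiffWithinAt J (𝓡 (d + 1)) ∞ f s p := (Bundle.contMDiffWithinAt_totalSpace.1 hV).1
  have : ContMDiffWithinAt J ((𝓡 (d + 1)).prod 𝓘(ℝ)) ∞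
      (fun m ↦ Bundle.TotalSpace.mk' ℝ (E := Bundle.Trivial M ℝ) (f m) (S.g (f m) (V m) (W m)))
      s p := by
    apply ContMDiffWithinAt.clm_bundle_apply₂ (F₁ := EuclideanSpace ℝ (Fin (d + 1)))
      (F₂ := EuclideanSpace ℝ (Fin (d + 1)))
    · exact ContMDiffAt.comp_contMDiffWithinAt p S.g_smooth.contMDiffAt hf
    · exact hV
    · exact hW
  simp only [Bundle.contMDiffWithinAt_totalSpace] at this
  exact this.2

theorem Spacetime.mdifferentiableAt_metric (S : Spacetime d M) {f : N → M} {p : N}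
    {V W : ∀ q : N, TangentSpace (𝓡 (d + 1)) (f q)}
    (hV : MDifferentiableAt J (𝓡 (d + 1)).tangent
      (fun q => (⟨f q, V q⟩ : TangentBundle (𝓡 (d + 1)) M)) p)
    (hW : MDifferentiableAt J (𝓡 (d + 1)).tangent
      (fun q => (⟨f q, W q⟩ : TangentBundle (𝓡 (d + 1)) M)) p) :
    MDifferentiableAt J 𝓘(ℝ, ℝ) (fun q => S.g (f q) (V q) (W q)) p := by
  have hf : MDifferentiableAt J (𝓡 (d + 1)) f p := ((mdifferentiableAt_totalSpace _ _).1 hV).1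
  have : MDifferentiableAt J ((𝓡 (d + 1)).prod 𝓘(ℝ))
      (fun m ↦ Bundle.TotalSpace.mk' ℝ (E := Bundle.Trivial M ℝ) (f m) (S.g (f m) (V m) (W m)))
      p := by
    apply MDifferentiableAt.clm_bundle_apply₂ (F₁ := EuclideanSpace ℝ (Fin (d + 1)))
      (F₂ := EuclideanSpace ℝ (Fin (d + 1)))
    · exact (S.g_smooth.mdifferentiableAt (by simp)).comp p hf
    · exact hV
    · exact hW
  simp only [mdifferentiableAt_totalSpace] at this
  exact this.2

/-- The connection of a spacetime is metric along maps, when one of the two fields is the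
restriction of an ambient one. -/
theorem IsLeviCivita.hasMFDerivAt_metric_along {S : Spacetime d M} {D : Connection (d + 1) M}
    (hD : IsLeviCivita S D) {f : N → M} {V : ∀ q : N, TangentSpace (𝓡 (d + 1)) (f q)} {p : N}
    {τ : ∀ y : M, TangentSpace (𝓡 (d + 1)) y}
    (hV : MDifferentiableAt J (𝓡 (d + 1)).tangent
      (fun q => (⟨f q, V q⟩ : TangentBundle (𝓡 (d + 1)) M)) p)
    (hτ : MDifferentiableAt (𝓡 (d + 1)) (𝓡 (d + 1)).tangent
      (fun y => (⟨y, τ y⟩ : TangentBundle (𝓡 (d + 1)) M)) (f p)) (v : TangentSpace J p) :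
    (mfderiv J 𝓘(ℝ, ℝ) (fun q => S.g (f q) (V q) (τ (f q))) p v : ℝ) =
      S.g (f p) (covDerivAlong D J f V p v) (τ (f p)) +
        S.g (f p) (V p) (D τ (f p) (mfderiv J (𝓡 (d + 1)) f p v)) := by
  obtain ⟨hf, hc⟩ := (mdifferentiableAt_totalSpace _ _).1 hV
  set e := trivializationAt (EuclideanSpace ℝ (Fin (d + 1)))
    (TangentSpace (𝓡 (d + 1)) : M → Type _) (f p) with he
  change MDifferentiableAt J (𝓡 (d + 1)) f p at hf
  set c : N → EuclideanSpace ℝ (Fin (d + 1)) := fun q => (e ⟨f q, V q⟩).2 with hcdef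
  change MDifferentiableAt J 𝓘(ℝ, EuclideanSpace ℝ (Fin (d + 1))) c p at hc
  have hbase : f p ∈ e.baseSet := FiberBundle.mem_baseSet_trivializationAt' (f p)
  -- the constant-coefficient sections
  have hσ : ∀ w : EuclideanSpace ℝ (Fin (d + 1)),
      MDifferentiableAt (𝓡 (d + 1)) (𝓡 (d + 1)).tangent
        (fun x => (⟨x, e.symm x w⟩ : TangentBundle (𝓡 (d + 1)) M)) (f p) := by
    intro w
    rw [mdifferentiableAt_section]
    refine (mdifferentiableAt_const (c := w)).congr_of_eventuallyEq ?_
    filter_upwards [e.open_baseSet.mem_nhds hbase] with x hx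
    rw [← he, e.apply_mk_symm hx]
  set G : EuclideanSpace ℝ (Fin (d + 1)) → M → ℝ := fun w x => S.g x (e.symm x w) (τ x) with hG
  have hGd : ∀ w, MDifferentiableAt (𝓡 (d + 1)) 𝓘(ℝ, ℝ) (G w) (f p) := fun w =>
    S.mdifferentiableAt_metric (hσ w) hτ
  let b := EuclideanSpace.basisFun (Fin (d + 1)) ℝ
  have hlin : ∀ x ∈ e.baseSet, ∀ w, G w x = ∑ i, w i * G (b i) x := by
    intro x hx w
    have h1 : e.symm x w = ∑ i, w i • e.symm x (b i) := by
      have := congrArg (e.symmL ℝ x) (b.sum_repr w).symm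
      simp only [map_sum, map_smul, b, EuclideanSpace.basisFun_repr] at this
      simpa only [e.symmL_apply hx] using this
    simp only [hG]
    rw [h1]
    simp
  -- Freezing the coefficients at `p` leaves the restriction of an ambient function, to which
  -- `hD.metric` applies; `R` is the remainder. Its factors `c q i - c p i` vanish at `p`, so only
  -- the derivative of `c` contributes.
  set R : N → ℝ := fun q => ∑ i, (c q i - c p i) * G (b i) (f q) with hR
  have hdec : (fun q => S.g (f q) (V q) (τ (f q))) =ᶠ[nhds p] fun q => G (c p) (f q) + R q := by
    filter_upwards [hf.continuousAt (e.open_baseSet.mem_nhds hbase)] with q hq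
    have h1 : e.symm (f q) (c q) = V q := e.symm_apply_apply_mk hq (V q)
    have h2 : S.g (f q) (V q) (τ (f q)) = G (c q) (f q) := by simp only [hG]; rw [h1]
    rw [h2, hlin _ hq (c q), hlin _ hq (c p), hR, ← Finset.sum_add_distrib]
    refine Finset.sum_congr rfl fun i _ => by ring
  set c' : E' →L[ℝ] EuclideanSpace ℝ (Fin (d + 1)) :=
    mfderiv J 𝓘(ℝ, EuclideanSpace ℝ (Fin (d + 1))) c p with hc'
  have hcd : HasMFDerivAt J 𝓘(ℝ, EuclideanSpace ℝ (Fin (d + 1))) c p c' := hc.hasMFDerivAt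
  set A : E' →L[ℝ] ℝ := ∑ i, G (b i) (f p) • ((EuclideanSpace.proj i :
    EuclideanSpace ℝ (Fin (d + 1)) →L[ℝ] ℝ).comp c') with hA
  have hRd : HasMFDerivAt J 𝓘(ℝ, ℝ) R p A := by
    have hRs : R = ∑ i, fun q => (c q i - c p i) * G (b i) (f q) := by
      ext q; simp [hR]
    rw [hRs]
    refine HasMFDerivAt.sum fun i _ => ?_
    have h1 : HasMFDerivAt J 𝓘(ℝ, ℝ) (fun q => c q i) p
        ((EuclideanSpace.proj i : EuclideanSpace ℝ (Fin (d + 1)) →L[ℝ] ℝ).comp c') :=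
      ((EuclideanSpace.proj i : EuclideanSpace ℝ (Fin (d + 1)) →L[ℝ] ℝ).hasMFDerivAt).comp p hcd
    have h2 := h1.sub (hasMFDerivAt_const (c p i) p)
    have h3 := ((hGd (b i)).hasMFDerivAt.comp p hf.hasMFDerivAt)
    set G' : E' →L[ℝ] ℝ := (mfderiv (𝓡 (d + 1)) 𝓘(ℝ, ℝ) (G (b i)) (f p)).comp
      (mfderiv J (𝓡 (d + 1)) f p) with hG'
    refine (h2.mul h3).congr_mfderiv (ContinuousLinearMap.ext fun (u : E') => ?_)
    change (c p i - c p i) * G' u + G (b i) (f p) * ((c' u) i - 0) = G (b i) (f p) * (c' u) i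
    ring
  set G' : E' →L[ℝ] ℝ := (mfderiv (𝓡 (d + 1)) 𝓘(ℝ, ℝ) (G (c p)) (f p)).comp
    (mfderiv J (𝓡 (d + 1)) f p) with hG'
  have hGp : HasMFDerivAt J 𝓘(ℝ, ℝ) (fun q => G (c p) (f q)) p G' :=
    (hGd (c p)).hasMFDerivAt.comp p hf.hasMFDerivAt
  rw [((hGp.add hRd).congr_of_eventuallyEq hdec).mfderiv]
  have hmet := hD.metric (f p) (mfderiv J (𝓡 (d + 1)) f p v) (fun x => e.symm x (c p)) τ
    (hσ _) hτ
  have hV0 : e.symm (f p) (c p) = V p := e.symm_apply_apply_mk hbase (V p)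
  have hcov : covDerivAlong D J f V p v =
      e.symm (f p) (mfderiv J 𝓘(ℝ, EuclideanSpace ℝ (Fin (d + 1))) c p v)
        + D (fun x => e.symm x (c p)) (f p) (mfderiv J (𝓡 (d + 1)) f p v) := rfl
  have hsum : S.g (f p) (e.symm (f p) (c' v)) (τ (f p)) = ∑ i, c' v i * G (b i) (f p) :=
    hlin (f p) hbase _
  have hAv : ∀ u : E', A u = ∑ i, c' u i * G (b i) (f p) := fun u => by
    simp [hA, sum_apply, mul_comm]
  have hcov' : S.g (f p) (covDerivAlong D J f V p v) (τ (f p)) =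
      S.g (f p) (e.symm (f p) (c' v)) (τ (f p)) + S.g (f p) (D (fun x => e.symm x (c p)) (f p)
        (mfderiv J (𝓡 (d + 1)) f p v)) (τ (f p)) := by
    rw [hcov, map_add]; rfl
  have hL : ∀ u : E', (G' + A) u = G' u + A u := fun u => rfl
  refine ((hL v).trans (congrArg (G' v + ·) (hAv v))).trans ?_
  rw [hcov', ← hV0, hsum, add_assoc, ← hmet]
  exact add_comm _ _

end Along

/-! ### Injectivity of the differential of an immersion -/

section Immersion

/-- In adapted charts the immersion is `u ↦ (u, 0)`, which a linear projection `A` inverts. Hence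
the injective differential of the domain chart factors through that of `f`. -/
theorem injective_mfderiv_of_isImmersionAt {E F M N : Type*} [NormedAddCommGroup E]
    [NormedSpace ℝ E] [NormedAddCommGroup F] [NormedSpace ℝ F] [TopologicalSpace M]
    [ChartedSpace E M] [TopologicalSpace N] [ChartedSpace F N] [IsManifold 𝓘(ℝ, E) ∞ M]
    [IsManifold 𝓘(ℝ, F) ∞ N] {f : M → N} {x : M}
    (hf : Manifold.IsImmersionAt 𝓘(ℝ, E) 𝓘(ℝ, F) ∞ f x) :
    Function.Injective (mfderiv 𝓘(ℝ, E) 𝓘(ℝ, F) f x) := by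
  have hφ : hf.domChart.MDifferentiable 𝓘(ℝ, E) 𝓘(ℝ, E) :=
    ⟨(contMDiffOn_of_mem_maximalAtlas hf.domChart_mem_maximalAtlas).mdifferentiableOn (by simp),
      (contMDiffOn_symm_of_mem_maximalAtlas
        hf.domChart_mem_maximalAtlas).mdifferentiableOn (by simp)⟩
  have hψ : MDifferentiableAt 𝓘(ℝ, F) 𝓘(ℝ, F) hf.codChart (f x) :=
    ((contMDiffOn_of_mem_maximalAtlas hf.codChart_mem_maximalAtlas).contMDiffAt
      (hf.codChart.open_source.mem_nhds hf.mem_codChart_source)).mdifferentiableAt (by simp)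
  have hfd : MDifferentiableAt 𝓘(ℝ, E) 𝓘(ℝ, F) f x := hf.contMDiffAt.mdifferentiableAt (by simp)
  set A : F →L[ℝ] E := (ContinuousLinearMap.fst ℝ E hf.complement).comp
    (hf.equiv.symm : F →L[ℝ] E × hf.complement) with hA
  have h1 : HasMFDerivAt 𝓘(ℝ, E) 𝓘(ℝ, E) hf.domChart x
      (A.comp ((mfderiv 𝓘(ℝ, F) 𝓘(ℝ, F) hf.codChart (f x)).comp
        (mfderiv 𝓘(ℝ, E) 𝓘(ℝ, F) f x))) := by
    refine ((A.hasMFDerivAt (x := hf.codChart (f x))).comp x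
      (hψ.hasMFDerivAt.comp x hfd.hasMFDerivAt)).congr_of_eventuallyEq ?_
    filter_upwards [hf.domChart.open_source.mem_nhds hf.mem_domChart_source] with y hy
    have hy' : y ∈ (hf.domChart.extend 𝓘(ℝ, E)).source := by simpa using hy
    have h2 := hf.writtenInCharts ((hf.domChart.extend 𝓘(ℝ, E)).map_source hy')
    simp only [Function.comp_apply, (hf.domChart.extend 𝓘(ℝ, E)).left_inv hy'] at h2
    change hf.codChart (f y) = hf.equiv (hf.domChart y, 0) at h2
    simp [hA, h2]
  have h4 := hφ.mfderiv_injective hf.mem_domChart_source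
  rw [h1.mfderiv] at h4
  refine fun u v huv => h4 ?_
  change A (mfderiv 𝓘(ℝ, F) 𝓘(ℝ, F) hf.codChart (f x) (mfderiv 𝓘(ℝ, E) 𝓘(ℝ, F) f x u)) =
    A (mfderiv 𝓘(ℝ, F) 𝓘(ℝ, F) hf.codChart (f x) (mfderiv 𝓘(ℝ, E) 𝓘(ℝ, F) f x v))
  rw [huv]

end Immersion

/-! ### Rotations of the fibres and the vertical field -/

section CircleBundle

variable {d k : ℕ} {H B : Type*} [TopologicalSpace H]
  [ChartedSpace (EuclideanSpace ℝ (Fin d)) H] [TopologicalSpace B]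
  [ChartedSpace (EuclideanSpace ℝ (Fin k)) B] {proj : H → B}

/-- The rotation by the angle `z.2` in the fibre through `z.1`, in a trivialization. -/
noncomputable def rot (e : Bundle.Trivialization Circle proj) (z : H × ℝ) : H :=
  e.toOpenPartialHomeomorph.symm (proj z.1, (e z.1).2 * Circle.exp z.2)

variable {e : Bundle.Trivialization Circle proj} {p : H}

theorem rot_mem_source (hp : p ∈ e.source) (s : ℝ) : rot e (p, s) ∈ e.source :=
  e.map_target (e.mem_target.2 (e.mem_source.1 hp))

theorem apply_rot (hp : p ∈ e.source) (s : ℝ) :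
    e (rot e (p, s)) = (proj p, (e p).2 * Circle.exp s) :=
  e.apply_symm_apply (e.mem_target.2 (e.mem_source.1 hp))

theorem proj_rot (hp : p ∈ e.source) (s : ℝ) : proj (rot e (p, s)) = proj p := by
  rw [← e.coe_fst (rot_mem_source hp s), apply_rot hp]

theorem rot_zero (hp : p ∈ e.source) : rot e (p, 0) = p := by
  simp only [rot, Circle.exp_zero, mul_one]
  exact e.symm_apply_mk_proj hp

theorem rot_rot (hp : p ∈ e.source) (s t : ℝ) : rot e (rot e (p, s), t) = rot e (p, s + t) := by
  simp only [rot.eq_1 e (_, t)]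
  rw [proj_rot hp, apply_rot hp]
  simp only [rot, Circle.exp_add, mul_assoc]

theorem rot_periodic (p : H) : Function.Periodic (fun s => rot e (p, s)) (2 * Real.pi) := by
  intro s
  simp only [rot, Circle.exp_add, Circle.exp_two_pi, mul_one]

/-- A trivialization of a smooth circle bundle which is a diffeomorphism. -/
structure IsSmoothTrivialization (d k : ℕ) {H B : Type*} [TopologicalSpace H]
    [ChartedSpace (EuclideanSpace ℝ (Fin d)) H] [TopologicalSpace B]
    [ChartedSpace (EuclideanSpace ℝ (Fin k)) B] {proj : H → B}
    (e : Bundle.Trivialization Circle proj) : Prop where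
  smooth : ContMDiffOn (𝓡 d) ((𝓡 k).prod (𝓡 1)) ∞ e e.source
  smooth_symm : ContMDiffOn ((𝓡 k).prod (𝓡 1)) (𝓡 d) ∞ e.toOpenPartialHomeomorph.symm e.target

theorem IsSmoothTrivialization.contMDiffOn_rot (he : IsSmoothTrivialization d k e) :
    ContMDiffOn ((𝓡 d).prod 𝓘(ℝ, ℝ)) (𝓡 d) ∞ (rot e) (e.source ×ˢ Set.univ) := by
  have h1 : ContMDiffOn ((𝓡 d).prod 𝓘(ℝ, ℝ)) ((𝓡 k).prod (𝓡 1)) ∞ (fun z : H × ℝ => e z.1)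
      (e.source ×ˢ Set.univ) := he.smooth.comp contMDiffOn_fst fun z hz => hz.1
  have h2 : ContMDiffOn ((𝓡 d).prod 𝓘(ℝ, ℝ)) ((𝓡 k).prod (𝓡 1)) ∞
      (fun z : H × ℝ => ((e z.1).1, (e z.1).2 * Circle.exp z.2)) (e.source ×ˢ Set.univ) := by
    refine (contMDiff_fst.comp_contMDiffOn h1).prodMk ?_
    exact ContMDiffOn.mul (contMDiff_snd.comp_contMDiffOn h1)
      ((contMDiff_circleExp (m := ∞)).comp_contMDiffOn contMDiffOn_snd)
  refine (he.smooth_symm.comp h2 fun z hz => ?_).congr fun z hz => ?_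
  · rw [Set.mem_preimage, e.mem_target, e.coe_fst hz.1]
    exact e.mem_source.1 hz.1
  · simp only [rot, Function.comp, e.coe_fst hz.1]

theorem IsSmoothTrivialization.contMDiffOn_proj (he : IsSmoothTrivialization d k e) :
    ContMDiffOn (𝓡 d) (𝓡 k) ∞ proj e.source :=
  (contMDiff_fst.comp_contMDiffOn he.smooth).congr fun _ hz => (e.coe_fst hz).symm

/-- The vertical field of a trivialization, generating the rotations of the fibres. -/
noncomputable def vert (d : ℕ) {H B : Type*} [TopologicalSpace H]
    [ChartedSpace (EuclideanSpace ℝ (Fin d)) H] [TopologicalSpace B] {proj : H → B}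
    (e : Bundle.Trivialization Circle proj) (p : H) : TangentSpace (𝓡 d) p :=
  mfderiv 𝓘(ℝ, ℝ) (𝓡 d) (fun s : ℝ => rot e (p, s)) 0 (1 : ℝ)

theorem IsSmoothTrivialization.contMDiff_rot_right (he : IsSmoothTrivialization d k e)
    (hp : p ∈ e.source) : ContMDiff 𝓘(ℝ, ℝ) (𝓡 d) ∞ (fun s : ℝ => rot e (p, s)) := by
  rw [← contMDiffOn_univ]
  exact he.contMDiffOn_rot.comp (contMDiff_const.prodMk contMDiff_id).contMDiffOn
    fun s _ => ⟨hp, Set.mem_univ _⟩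

theorem IsSmoothTrivialization.mfderiv_rot (he : IsSmoothTrivialization d k e)
    (hp : p ∈ e.source) (s : ℝ) :
    mfderiv 𝓘(ℝ, ℝ) (𝓡 d) (fun s : ℝ => rot e (p, s)) s (1 : ℝ) = vert d e (rot e (p, s)) := by
  have h1 : (fun t : ℝ => rot e (p, t)) = (fun t => rot e (rot e (p, s), t)) ∘ fun t => t - s := by
    ext t
    simp [rot_rot hp]
  have h2 : HasMFDerivAt 𝓘(ℝ, ℝ) 𝓘(ℝ, ℝ) (fun t : ℝ => t - s) s (ContinuousLinearMap.id ℝ ℝ) :=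
    ((hasFDerivAt_id s).sub_const s).hasMFDerivAt
  have h3 : MDifferentiableAt 𝓘(ℝ, ℝ) (𝓡 d) (fun t => rot e (rot e (p, s), t)) (s - s) :=
    (he.contMDiff_rot_right (rot_mem_source hp s)).mdifferentiableAt (by simp)
  have h4 := HasMFDerivAt.comp (f := fun t : ℝ => t - s) s h3.hasMFDerivAt h2
  rw [← h1] at h4
  -- The base point `s - s` equals `0` only propositionally; comparing values in the model space
  -- avoids transport between tangent spaces.
  have aux : ∀ a : ℝ, a = 0 → (mfderiv 𝓘(ℝ, ℝ) (𝓡 d) (fun t => rot e (rot e (p, s), t)) a (1 : ℝ) :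
      EuclideanSpace ℝ (Fin d)) = vert d e (rot e (p, s)) := by rintro a rfl; rfl
  exact (DFunLike.congr_fun h4.mfderiv (1 : ℝ)).trans (aux _ (sub_self s))

/-- The vertical field is the tangent map of `rot e` applied to the smooth field `(0, ∂/∂s)` along
`s = 0`. -/
theorem IsSmoothTrivialization.contMDiffOn_vert [IsManifold (𝓡 d) ∞ H]
    (he : IsSmoothTrivialization d k e) :
    ContMDiffOn (𝓡 d) (𝓡 d).tangent ∞
      (fun p => (⟨p, vert d e p⟩ : TangentBundle (𝓡 d) H)) e.source := by
  have hopen : IsOpen (e.source ×ˢ (Set.univ : Set ℝ)) := e.open_source.prod isOpen_univ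
  have h1 := he.contMDiffOn_rot.contMDiffOn_tangentMapWithin (m := ∞) (by simp)
    hopen.uniqueMDiffOn
  have h2 : ContMDiff (𝓡 d) ((𝓡 d).prod 𝓘(ℝ, ℝ)).tangent ∞
      (fun p : H => (equivTangentBundleProd (𝓡 d) H 𝓘(ℝ, ℝ) ℝ).symm
        ((⟨p, 0⟩ : TangentBundle (𝓡 d) H), (⟨0, (1 : ℝ)⟩ : TangentBundle 𝓘(ℝ, ℝ) ℝ))) :=
    contMDiff_equivTangentBundleProd_symm.comp
      ((Bundle.contMDiff_zeroSection ℝ (TangentSpace (𝓡 d) : H → Type _)).prodMk contMDiff_const)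
  refine (h1.comp h2.contMDiffOn (s := e.source) fun p hp => ⟨hp, Set.mem_univ _⟩).congr
    fun p hp => ?_
  have aux : ∀ (q : H) (y : EuclideanSpace ℝ (Fin d)), q = p →
      (⟨p, y⟩ : TangentBundle (𝓡 d) H) = ⟨q, y⟩ := by rintro q y rfl; rfl
  refine Eq.trans ?_ (aux (rot e (p, 0)) _ (rot_zero hp))
  have hd : MDifferentiableAt ((𝓡 d).prod 𝓘(ℝ, ℝ)) (𝓡 d) (rot e) (p, (0 : ℝ)) :=
    (he.contMDiffOn_rot.contMDiffAt (hopen.mem_nhds ⟨hp, Set.mem_univ _⟩)).mdifferentiableAt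
      (by simp)
  have h3 : HasMFDerivAt 𝓘(ℝ, ℝ) ((𝓡 d).prod 𝓘(ℝ, ℝ)) (fun s : ℝ => (p, s)) 0 _ :=
    (hasMFDerivAt_const p (0 : ℝ)).prodMk (hasMFDerivAt_id (0 : ℝ))
  have h4 := hd.hasMFDerivAt.comp (0 : ℝ) h3
  have h5 := DFunLike.congr_fun h4.mfderiv (1 : ℝ)
  have h6 : mfderivWithin ((𝓡 d).prod 𝓘(ℝ, ℝ)) (𝓡 d) (rot e) (e.source ×ˢ (Set.univ : Set ℝ))
      (p, (0 : ℝ)) = mfderiv ((𝓡 d).prod 𝓘(ℝ, ℝ)) (𝓡 d) (rot e) (p, (0 : ℝ)) :=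
    mfderivWithin_of_isOpen hopen ⟨hp, Set.mem_univ _⟩
  refine congrArg (fun y : EuclideanSpace ℝ (Fin d) => (⟨p, y⟩ : TangentBundle (𝓡 d) H)) ?_
  exact h5.trans (DFunLike.congr_fun h6.symm ((0 : EuclideanSpace ℝ (Fin d)), (1 : ℝ)))

end CircleBundle

/-! ### Angular coordinate of a curve in a fibre -/

section FibreCurves

variable {d k : ℕ} {H B : Type*} [TopologicalSpace H]
  [ChartedSpace (EuclideanSpace ℝ (Fin d)) H] [TopologicalSpace B]
  [ChartedSpace (EuclideanSpace ℝ (Fin k)) B] {proj : H → B}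
  {e : Bundle.Trivialization Circle proj} {p : H}

/-- Dividing the circle component of the curve by that of `p` gives a curve in `Circle`, whose lift
is the angle. This reduces statements about generators to one real variable. -/
theorem IsSmoothTrivialization.exists_angle (he : IsSmoothTrivialization d k e) {γ : ℝ → H}
    (hγ : ContMDiff 𝓘(ℝ, ℝ) (𝓡 d) ∞ γ) (hp : p ∈ e.source) (hfib : ∀ t, proj (γ t) = proj p) :
    ∃ s w : ℝ → ℝ, (∀ t, HasDerivAt s (w t) t) ∧ (∀ t, γ t = rot e (p, s t)) ∧
      ∀ t, mfderiv 𝓘(ℝ, ℝ) (𝓡 d) γ t (1 : ℝ) = w t • vert d e (γ t) := by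
  have hsrc : ∀ t, γ t ∈ e.source := fun t => by
    rw [e.mem_source, hfib]; exact e.mem_source.1 hp
  have h1 : ContMDiff 𝓘(ℝ, ℝ) ((𝓡 k).prod (𝓡 1)) ∞ (fun t => e (γ t)) := by
    rw [← contMDiffOn_univ]
    exact he.smooth.comp hγ.contMDiffOn fun t _ => hsrc t
  have h2 : ContMDiff 𝓘(ℝ, ℝ) (𝓡 1) ∞ (fun t => (e p).2⁻¹ * (e (γ t)).2) :=
    contMDiff_const.mul (contMDiff_snd.comp h1)
  obtain ⟨s, w, hs, hc⟩ := exists_lift_circle h2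
  have hrot : ∀ t, γ t = rot e (p, s t) := fun t => by
    simp only [rot]
    rw [hc, mul_inv_cancel_left, ← hfib t]
    exact (e.symm_apply_mk_proj (hsrc t)).symm
  refine ⟨s, w, hs, hrot, fun t => ?_⟩
  have h3 : γ = (fun u : ℝ => rot e (p, u)) ∘ s := funext hrot
  have h4 := HasMFDerivAt.comp (f := s) t (((he.contMDiff_rot_right hp).mdifferentiableAt
    (by simp)).hasMFDerivAt) (hs t).hasFDerivAt.hasMFDerivAt
  rw [← h3] at h4
  rw [hrot t]
  have h5 := DFunLike.congr_fun h4.mfderiv (1 : ℝ)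
  refine h5.trans ?_
  rw [← he.mfderiv_rot hp (s t)]
  have h6 : ∀ L : ℝ →L[ℝ] EuclideanSpace ℝ (Fin d),
      L (ContinuousLinearMap.toSpanSingleton ℝ (w t) (1 : ℝ)) = w t • L 1 := fun L => by
    rw [← map_smul]; simp
  exact h6 _

end FibreCurves

/-! ### Pairings with the time field on the horizon -/

section HorizonFunctions

noncomputable section

variable {d : ℕ} {M : Type*} [TopologicalSpace M]
  [ChartedSpace (EuclideanSpace ℝ (Fin (d + 1))) M] [IsManifold (𝓡 (d + 1)) ∞ M]
  {H : Type*} [TopologicalSpace H] [ChartedSpace (EuclideanSpace ℝ (Fin d)) H]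

/-- The pairing of a tangent vector of `H` with the time field. -/
def timePairing (S : Spacetime d M) (ι : H → M) (p : H) (v : TangentSpace (𝓡 d) p) : ℝ :=
  S.g (ι p) (mfderiv (𝓡 d) (𝓡 (d + 1)) ι p v) (S.time (ι p))

/-- The quadratic form `v ↦ g(v, ∇_v T)` on the tangent spaces of `H`, for the time field `T`. -/
def timeShear (S : Spacetime d M) (D : Connection (d + 1) M) (ι : H → M) (p : H)
    (v : TangentSpace (𝓡 d) p) : ℝ :=
  S.g (ι p) (mfderiv (𝓡 d) (𝓡 (d + 1)) ι p v)
    (D S.time (ι p) (mfderiv (𝓡 d) (𝓡 (d + 1)) ι p v))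

variable {S : Spacetime d M} {D : Connection (d + 1) M} {ι : H → M} {p : H}

theorem timePairing_smul (c : ℝ) (v : TangentSpace (𝓡 d) p) :
    timePairing S ι p (c • v) = c * timePairing S ι p v := by
  simp [timePairing]

theorem timeShear_smul (c : ℝ) (v : TangentSpace (𝓡 d) p) :
    timeShear S D ι p (c • v) = c ^ 2 * timeShear S D ι p v := by
  simp only [timeShear, map_smul, smul_apply, smul_eq_mul]
  ring

theorem timePairing_ne_zero {v : TangentSpace (𝓡 d) p}
    (hι : Function.Injective (mfderiv (𝓡 d) (𝓡 (d + 1)) ι p)) (hv : v ≠ 0)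
    (hnull : inducedForm S ι p v v = 0) : timePairing S ι p v ≠ 0 := by
  obtain ⟨b, hb⟩ := S.g_signature (ι p)
  rw [timePairing, S.g_symm]
  refine pairing_ne_zero_of_timelike_of_lightlike (S.g (ι p)) b hb (S.time_timelike _) hnull ?_
  intro h
  exact hv (hι (h.trans (map_zero _).symm))

/-- Metricity along a curve of the horizon: the derivative of the pairing of the velocity with the
time field, for an affinely parametrized geodesic. -/
theorem IsLeviCivita.hasDerivAt_timePairing (hD : IsLeviCivita S D)
    (hι : ContMDiff (𝓡 d) (𝓡 (d + 1)) ∞ ι) {γ : ℝ → H} (hγ : ContMDiff 𝓘(ℝ, ℝ) (𝓡 d) ∞ γ) {t : ℝ}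
    (hgeo : covDerivAlong D 𝓘(ℝ, ℝ) (ι ∘ γ)
      (fun s => mfderiv 𝓘(ℝ, ℝ) (𝓡 (d + 1)) (ι ∘ γ) s (1 : ℝ)) t (1 : ℝ) = 0) :
    HasDerivAt (fun t => timePairing S ι (γ t) (mfderiv 𝓘(ℝ, ℝ) (𝓡 d) γ t (1 : ℝ)))
      (timeShear S D ι (γ t) (mfderiv 𝓘(ℝ, ℝ) (𝓡 d) γ t (1 : ℝ))) t := by
  have hιγ : ContMDiff 𝓘(ℝ, ℝ) (𝓡 (d + 1)) ∞ (ι ∘ γ) := hι.comp hγ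
  have h1 : ContMDiff 𝓘(ℝ, ℝ) 𝓘(ℝ, ℝ).tangent ∞
      (fun s : ℝ => (⟨s, (1 : ℝ)⟩ : TangentBundle 𝓘(ℝ, ℝ) ℝ)) :=
    contMDiff_vectorSpace_iff_contDiff.2 contDiff_const
  have hV : ContMDiff 𝓘(ℝ, ℝ) (𝓡 (d + 1)).tangent ∞ (fun s : ℝ => (⟨(ι ∘ γ) s,
      mfderiv 𝓘(ℝ, ℝ) (𝓡 (d + 1)) (ι ∘ γ) s (1 : ℝ)⟩ : TangentBundle (𝓡 (d + 1)) M)) :=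
    (hιγ.contMDiff_tangentMap (m := ∞) (by simp)).comp h1
  have hchain : ∀ s, mfderiv 𝓘(ℝ, ℝ) (𝓡 (d + 1)) (ι ∘ γ) s (1 : ℝ) =
      mfderiv (𝓡 d) (𝓡 (d + 1)) ι (γ s) (mfderiv 𝓘(ℝ, ℝ) (𝓡 d) γ s (1 : ℝ)) := fun s =>
    DFunLike.congr_fun (mfderiv_comp s (hι.mdifferentiableAt (by simp))
      (hγ.mdifferentiableAt (by simp))) (1 : ℝ)
  have hτ : ContMDiff 𝓘(ℝ, ℝ) (𝓡 (d + 1)).tangent ∞ (fun s : ℝ => (⟨(ι ∘ γ) s,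
      S.time ((ι ∘ γ) s)⟩ : TangentBundle (𝓡 (d + 1)) M)) := S.time_smooth.comp hιγ
  have hmet := hD.hasMFDerivAt_metric_along (J := 𝓘(ℝ, ℝ)) (hV.mdifferentiableAt (by simp))
    (S.time_smooth.mdifferentiableAt (by simp)) (1 : ℝ) (p := t)
  have hdiff := S.mdifferentiableAt_metric (hV.mdifferentiableAt (by simp) (x := t))
    (hτ.mdifferentiableAt (by simp))
  rw [hgeo, map_zero, zero_apply, zero_add] at hmet
  have hfun : (fun t => timePairing S ι (γ t) (mfderiv 𝓘(ℝ, ℝ) (𝓡 d) γ t (1 : ℝ))) =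
      fun q => S.g ((ι ∘ γ) q) (mfderiv 𝓘(ℝ, ℝ) (𝓡 (d + 1)) (ι ∘ γ) q (1 : ℝ))
        (S.time ((ι ∘ γ) q)) := by
    ext s; rw [hchain]; rfl
  rw [hfun]
  have hder := (hdiff.differentiableAt).hasDerivAt
  refine hder.congr_deriv ?_
  rw [mfderiv_eq_fderiv] at hmet
  refine hmet.trans ?_
  rw [hchain]
  rfl

variable [IsManifold (𝓡 d) ∞ H]

theorem contMDiffOn_pushforward (hι : ContMDiff (𝓡 d) (𝓡 (d + 1)) ∞ ι)
    {X : ∀ p : H, TangentSpace (𝓡 d) p} {W : Set H}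
    (hX : ContMDiffOn (𝓡 d) (𝓡 d).tangent ∞ (fun p => (⟨p, X p⟩ : TangentBundle (𝓡 d) H)) W) :
    ContMDiffOn (𝓡 d) (𝓡 (d + 1)).tangent ∞ (fun p =>
      (⟨ι p, mfderiv (𝓡 d) (𝓡 (d + 1)) ι p (X p)⟩ : TangentBundle (𝓡 (d + 1)) M)) W :=
  (hι.contMDiff_tangentMap (m := ∞) (by simp)).comp_contMDiffOn hX

theorem contMDiffOn_timePairing (hι : ContMDiff (𝓡 d) (𝓡 (d + 1)) ∞ ι)
    {X : ∀ p : H, TangentSpace (𝓡 d) p} {W : Set H}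
    (hX : ContMDiffOn (𝓡 d) (𝓡 d).tangent ∞ (fun p => (⟨p, X p⟩ : TangentBundle (𝓡 d) H)) W) :
    ContMDiffOn (𝓡 d) 𝓘(ℝ, ℝ) ∞ (fun p => timePairing S ι p (X p)) W := fun p hp =>
  S.contMDiffWithinAt_metric (contMDiffOn_pushforward hι hX p hp)
    ((S.time_smooth.comp hι).contMDiffAt.contMDiffWithinAt)

theorem contMDiffOn_timeShear (hD : IsLeviCivita S D) (hι : ContMDiff (𝓡 d) (𝓡 (d + 1)) ∞ ι)
    {X : ∀ p : H, TangentSpace (𝓡 d) p} {W : Set H}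
    (hX : ContMDiffOn (𝓡 d) (𝓡 d).tangent ∞ (fun p => (⟨p, X p⟩ : TangentBundle (𝓡 d) H)) W) :
    ContMDiffOn (𝓡 d) 𝓘(ℝ, ℝ) ∞ (fun p => timeShear S D ι p (X p)) W := by
  have hpush := contMDiffOn_pushforward hι hX
  have h1 : ContMDiff (𝓡 (d + 1)) ((𝓡 (d + 1)).prod 𝓘(ℝ, EuclideanSpace ℝ (Fin (d + 1)) →L[ℝ]
      EuclideanSpace ℝ (Fin (d + 1)))) ∞ (fun x => Bundle.TotalSpace.mk'
        (EuclideanSpace ℝ (Fin (d + 1)) →L[ℝ] EuclideanSpace ℝ (Fin (d + 1)))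
        (E := fun x : M => TangentSpace (𝓡 (d + 1)) x →L[ℝ] TangentSpace (𝓡 (d + 1)) x)
        x (D S.time x)) := by
    rw [← contMDiffOn_univ]
    exact hD.smooth.contMDiff.contMDiff (S.time_smooth.of_le (by simp)).contMDiffOn
  intro p hp
  exact S.contMDiffWithinAt_metric (hpush p hp)
    (((h1.comp hι).contMDiffAt.contMDiffWithinAt).clm_bundle_apply (hpush p hp))

end

end HorizonFunctions

/-! ### Positive solutions of the fibrewise equation over a trivialization -/

section LocalScaling

variable {d k : ℕ} {H B : Type*} [TopologicalSpace H]
  [ChartedSpace (EuclideanSpace ℝ (Fin d)) H] [TopologicalSpace B]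
  [ChartedSpace (EuclideanSpace ℝ (Fin k)) B] {proj : H → B}
  {e : Bundle.Trivialization Circle proj} {p : H}

/-- The derivative of a real function on a manifold in the direction of a tangent vector. -/
noncomputable def dirDeriv (F : H → ℝ) (p : H) (v : TangentSpace (𝓡 d) p) : ℝ :=
  mfderiv (𝓡 d) 𝓘(ℝ, ℝ) F p v

theorem dirDeriv_smul (F : H → ℝ) (c : ℝ) (v : TangentSpace (𝓡 d) p) :
    dirDeriv F p (c • v) = c * dirDeriv F p v := by
  rw [dirDeriv, map_smul]; rfl

theorem IsSmoothTrivialization.hasDerivAt_comp_rot (he : IsSmoothTrivialization d k e)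
    (hp : p ∈ e.source) {F : H → ℝ} (hF : MDifferentiableAt (𝓡 d) 𝓘(ℝ, ℝ) F p) :
    HasDerivAt (fun s : ℝ => F (rot e (p, s))) (dirDeriv F p (vert d e p)) 0 := by
  obtain ⟨L, hL⟩ : ∃ L : EuclideanSpace ℝ (Fin d) →L[ℝ] ℝ,
    L = mfderiv (𝓡 d) 𝓘(ℝ, ℝ) F p := ⟨_, rfl⟩
  obtain ⟨R, hR⟩ : ∃ R : ℝ →L[ℝ] EuclideanSpace ℝ (Fin d),
    R = mfderiv 𝓘(ℝ, ℝ) (𝓡 d) (fun s : ℝ => rot e (p, s)) 0 := ⟨_, rfl⟩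
  have hFL : HasMFDerivAt (𝓡 d) 𝓘(ℝ, ℝ) F (rot e (p, 0)) L := by
    have : HasMFDerivAt (𝓡 d) 𝓘(ℝ, ℝ) F p L := hL ▸ hF.hasMFDerivAt
    rwa [rot_zero hp]
  have hrot : HasMFDerivAt 𝓘(ℝ, ℝ) (𝓡 d) (fun s : ℝ => rot e (p, s)) 0 R :=
    hR ▸ ((he.contMDiff_rot_right hp).mdifferentiableAt (by simp)).hasMFDerivAt
  have h2 : HasFDerivAt (fun s : ℝ => F (rot e (p, s))) (L.comp R) 0 :=
    (HasMFDerivAt.comp (f := fun s : ℝ => rot e (p, s)) (0 : ℝ) hFL hrot).hasFDerivAt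
  have h3 := h2.hasDerivAt
  rw [ContinuousLinearMap.comp_apply, hL, hR] at h3
  exact h3

variable [IsManifold (𝓡 d) ∞ H]

/-- With `K (p, s)` the integral of `κ` along the fibre from `p`, take `F p` to be the integral of
`exp K (p, s)` over a full turn. Zero holonomy makes `exp K` periodic, so moving the base point by
`t` shifts the window harmlessly and multiplies `F` by `exp (-K (p, t))`. Differentiating at `t = 0`
gives the equation. -/
theorem IsSmoothTrivialization.exists_scaling (he : IsSmoothTrivialization d k e) {κ : H → ℝ}
    (hκ : ContMDiffOn (𝓡 d) 𝓘(ℝ, ℝ) ∞ κ e.source)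
    (hκ0 : ∀ p ∈ e.source, ∫ u in (0 : ℝ)..2 * Real.pi, κ (rot e (p, u)) = 0) :
    ∃ F : H → ℝ, ContMDiffOn (𝓡 d) 𝓘(ℝ, ℝ) ∞ F e.source ∧ (∀ p ∈ e.source, 0 < F p) ∧
      ∀ p ∈ e.source, dirDeriv F p (vert d e p) = -(κ p * F p) := by
  set K : H × ℝ → ℝ := fun z => ∫ u in (0 : ℝ)..z.2, κ (rot e (z.1, u)) with hK
  set F : H → ℝ := fun p => ∫ s in (0 : ℝ)..2 * Real.pi, Real.exp (K (p, s)) with hF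
  have hW : IsOpen (e.source ×ˢ (Set.univ : Set ℝ)) := e.open_source.prod isOpen_univ
  have hKs : ContMDiffOn ((𝓡 d).prod 𝓘(ℝ, ℝ)) 𝓘(ℝ, ℝ) ∞ K (e.source ×ˢ Set.univ) := by
    -- Substituting `u = s v` moves the variable endpoint into the integrand, leaving the fixed
    -- interval from 0 to 1.
    have h1 : ContMDiffOn (((𝓡 d).prod 𝓘(ℝ, ℝ)).prod 𝓘(ℝ, ℝ)) 𝓘(ℝ, ℝ) ∞
        (fun z : (H × ℝ) × ℝ => κ (rot e (z.1.1, z.1.2 * z.2)))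
        ((e.source ×ˢ Set.univ) ×ˢ Set.univ) := by
      have h2 : ContMDiff (((𝓡 d).prod 𝓘(ℝ, ℝ)).prod 𝓘(ℝ, ℝ)) ((𝓡 d).prod 𝓘(ℝ, ℝ)) ∞
          (fun z : (H × ℝ) × ℝ => (z.1.1, z.1.2 * z.2)) :=
        (contMDiff_fst.comp contMDiff_fst).prodMk
          ((contMDiff_snd.comp contMDiff_fst).mul contMDiff_snd)
      exact hκ.comp (he.contMDiffOn_rot.comp h2.contMDiffOn
        fun z hz => ⟨hz.1.1, Set.mem_univ _⟩) fun z hz => rot_mem_source hz.1.1 _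
    have h3 := contMDiffOn_parametric_integral ((𝓡 d).prod 𝓘(ℝ, ℝ)) hW h1 0 1
    refine (contMDiffOn_snd.mul h3).congr fun z _ => ?_
    have := intervalIntegral.smul_integral_comp_mul_left (a := 0) (b := 1)
      (fun u => κ (rot e (z.1, u))) z.2
    simp only [mul_zero, mul_one, smul_eq_mul] at this
    simpa [hK] using this.symm
  have hFs : ContMDiffOn (𝓡 d) 𝓘(ℝ, ℝ) ∞ F e.source :=
    contMDiffOn_parametric_integral (𝓡 d) (f := fun z => Real.exp (K z)) e.open_source
      (Real.contDiff_exp.contMDiff.comp_contMDiffOn hKs) 0 (2 * Real.pi)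
  have hκc : ∀ p ∈ e.source, Continuous fun u => κ (rot e (p, u)) := fun p hp =>
    hκ.continuousOn.comp_continuous (he.contMDiff_rot_right hp).continuous
      fun s => rot_mem_source hp s
  have hKd : ∀ p ∈ e.source, ∀ s, HasDerivAt (fun s => K (p, s)) (κ (rot e (p, s))) s :=
    fun p hp s => intervalIntegral.integral_hasDerivAt_right ((hκc p hp).intervalIntegrable _ _)
      (hκc p hp).stronglyMeasurable.stronglyMeasurableAtFilter (hκc p hp).continuousAt
  have hKc : ∀ p ∈ e.source, Continuous fun s => Real.exp (K (p, s)) := fun p hp =>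
    Real.continuous_exp.comp (continuous_iff_continuousAt.2 fun s => (hKd p hp s).continuousAt)
  refine ⟨F, hFs, fun p hp => ?_, fun p hp => ?_⟩
  · exact intervalIntegral.intervalIntegral_pos_of_pos ((hKc p hp).intervalIntegrable _ _)
      (fun s => Real.exp_pos _) Real.two_pi_pos
  have hKper : Function.Periodic (fun s => Real.exp (K (p, s))) (2 * Real.pi) := fun s => by
    have hper : Function.Periodic (fun u => κ (rot e (p, u))) (2 * Real.pi) :=
      (rot_periodic p).comp κ
    have := hper.intervalIntegral_add_eq_add 0 s (fun a b => (hκc p hp).intervalIntegrable a b)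
    simp only [zero_add, hκ0 p hp, add_zero] at this
    simp only [hK, this]
  have hshift : ∀ t, F (rot e (p, t)) = Real.exp (-K (p, t)) * F p := fun t => by
    have h1 : ∀ s, K (rot e (p, t), s) = K (p, t + s) - K (p, t) := fun s => by
      simp only [hK, rot_rot hp]
      rw [intervalIntegral.integral_interval_sub_left ((hκc p hp).intervalIntegrable _ _)
        ((hκc p hp).intervalIntegrable _ _),
        intervalIntegral.integral_comp_add_left (fun u => κ (rot e (p, u))) t, add_zero]
    have h2 : ∫ s in (0 : ℝ)..2 * Real.pi, Real.exp (K (p, t + s)) = F p := by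
      have := hKper.intervalIntegral_add_eq t 0
      rw [intervalIntegral.integral_comp_add_left (fun s => Real.exp (K (p, s))) t]
      simpa [hF] using this
    simp only [hF, h1, sub_eq_neg_add, Real.exp_add]
    rw [intervalIntegral.integral_const_mul, h2]
  have h1 := he.hasDerivAt_comp_rot hp
    ((hFs.contMDiffAt (e.open_source.mem_nhds hp)).mdifferentiableAt (by simp))
  have h2 := (((hKd p hp 0).neg).exp).mul_const (F p)
  simp only [hshift] at h1
  refine (h1.unique h2).trans ?_
  rw [rot_zero hp]
  simp [hK]

end LocalScaling

/-! ### Generators as fibres, and their trivial holonomy -/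

section Holonomy

variable {d k : ℕ} {M : Type*} [TopologicalSpace M]
  [ChartedSpace (EuclideanSpace ℝ (Fin (d + 1))) M] [IsManifold (𝓡 (d + 1)) ∞ M]
  {H B : Type*} [TopologicalSpace H] [ChartedSpace (EuclideanSpace ℝ (Fin d)) H]
  [TopologicalSpace B] [ChartedSpace (EuclideanSpace ℝ (Fin k)) B] {proj : H → B}
  {S : Spacetime d M} {D : Connection (d + 1) M} {ι : H → M} {p : H}
  {e : Bundle.Trivialization Circle proj}

theorem IsSmoothTrivialization.exists_velocity_eq_smul_vert (he : IsSmoothTrivialization d k e)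
    (hp : p ∈ e.source) {γ : ℝ → H} (hγ : IsLightlikeCurve S ι γ)
    (hr : Set.range γ = proj ⁻¹' {proj p}) {t : ℝ} (ht : γ t = p) :
    ∃ c : ℝ, c ≠ 0 ∧ mfderiv 𝓘(ℝ, ℝ) (𝓡 d) γ t (1 : ℝ) = c • vert d e p := by
  obtain ⟨s, w, -, -, hw⟩ := he.exists_angle hγ.smooth hp fun t => by
    have : γ t ∈ proj ⁻¹' {proj p} := hr ▸ Set.mem_range_self t
    exact this
  subst ht
  refine ⟨w t, fun h0 => hγ.regular t ?_, hw t⟩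
  rw [hw t, h0, zero_smul]

/-- A lightlike curve sweeps out the fibre, and its regular velocity at `p` is a nonzero multiple of
the vertical vector. -/
theorem IsSmoothTrivialization.vert_lightlike (he : IsSmoothTrivialization d k e)
    (hp : p ∈ e.source) (hgen : IsGenerator S ι (proj ⁻¹' {proj p})) :
    vert d e p ≠ 0 ∧ inducedForm S ι p (vert d e p) (vert d e p) = 0 := by
  obtain ⟨γ, hγ, hr⟩ := hgen.1
  obtain ⟨t, ht⟩ : p ∈ Set.range γ := hr ▸ rfl
  obtain ⟨c, hc, hv⟩ := he.exists_velocity_eq_smul_vert hp hγ hr ht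
  have hreg := hγ.regular t
  have hnull := hγ.lightlike t
  subst ht
  rw [hv] at hreg hnull
  refine ⟨fun h => hreg (by rw [h, smul_zero]), ?_⟩
  simp only [inducedForm, map_smul, smul_apply, smul_eq_mul] at hnull ⊢
  simpa [hc] using hnull

/-- Any two vertical fields of trivializations are proportional. -/
theorem IsSmoothTrivialization.exists_vert_eq_smul_vert {e' : Bundle.Trivialization Circle proj}
    (he : IsSmoothTrivialization d k e) (he' : IsSmoothTrivialization d k e')
    (hp : p ∈ e.source) (hp' : p ∈ e'.source) (hgen : IsGenerator S ι (proj ⁻¹' {proj p})) :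
    ∃ c : ℝ, c ≠ 0 ∧ vert d e' p = c • vert d e p := by
  obtain ⟨γ, hγ, hr⟩ := hgen.1
  obtain ⟨t, ht⟩ : p ∈ Set.range γ := hr ▸ rfl
  obtain ⟨c, hc, hv⟩ := he.exists_velocity_eq_smul_vert hp hγ hr ht
  obtain ⟨c', hc', hv'⟩ := he'.exists_velocity_eq_smul_vert hp' hγ hr ht
  have h : c' • vert d e' p = c • vert d e p := hv'.symm.trans hv
  refine ⟨c'⁻¹ * c, mul_ne_zero (inv_ne_zero hc') hc, ?_⟩
  rw [mul_smul, ← h, inv_smul_smul₀ hc']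

variable [IsManifold (𝓡 d) ∞ H]

/-- The holonomy of a complete circular generator is trivial. -/
theorem IsSmoothTrivialization.integral_eq_zero_of_isCompleteGenerator
    (he : IsSmoothTrivialization d k e) (hD : IsLeviCivita S D)
    (hι : ContMDiff (𝓡 d) (𝓡 (d + 1)) ∞ ι)
    (hpair : ∀ q ∈ e.source, timePairing S ι q (vert d e q) ≠ 0)
    (hp : p ∈ e.source) (hcomp : IsCompleteGenerator S D ι (proj ⁻¹' {proj p})) :
    ∫ u in (0 : ℝ)..2 * Real.pi, -(timeShear S D ι (rot e (p, u)) (vert d e (rot e (p, u))) /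
      timePairing S ι (rot e (p, u)) (vert d e (rot e (p, u)))) = 0 := by
  obtain ⟨γ, hγ, hr, hgeo⟩ := hcomp
  obtain ⟨s, w, hs, hrot, hw⟩ := he.exists_angle hγ.smooth hp fun t => by
    have : γ t ∈ proj ⁻¹' {proj p} := hr ▸ Set.mem_range_self t
    exact this
  have hcτ := (contMDiffOn_timePairing (S := S) hι he.contMDiffOn_vert).continuousOn
  have hcσ := (contMDiffOn_timeShear hD hι he.contMDiffOn_vert).continuousOn
  have hrc := (he.contMDiff_rot_right hp).continuous
  have hτc := hcτ.comp_continuous hrc fun u => rot_mem_source hp u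
  have hσc := hcσ.comp_continuous hrc fun u => rot_mem_source hp u
  have hτ0 : ∀ u, timePairing S ι (rot e (p, u)) (vert d e (rot e (p, u))) ≠ 0 := fun u =>
    hpair _ (rot_mem_source hp u)
  -- Here `w * τ` is the pairing of the velocity with the time field. For an affine geodesic its
  -- derivative is `timeShear` of the velocity, which is quadratic in `w`; this is the required
  -- equation with `k = -σ / τ`.
  refine integral_period_eq_zero_of_complete (s := s) (w := w)
    (τ := fun u => timePairing S ι (rot e (p, u)) (vert d e (rot e (p, u))))
    Real.two_pi_pos ((hσc.div hτc hτ0).neg)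
    ((rot_periodic p).comp fun q => -(timeShear S D ι q (vert d e q) /
      timePairing S ι q (vert d e q)))
    hτc ((rot_periodic p).comp fun q => timePairing S ι q (vert d e q)) hτ0 hs
    (fun t h0 => hγ.regular t ?_) fun t => ?_
  · rw [hw t, h0, zero_smul]
  · have h1 := hD.hasDerivAt_timePairing hι hγ.smooth (hgeo t)
    have hfun : (fun t => timePairing S ι (γ t) (mfderiv 𝓘(ℝ, ℝ) (𝓡 d) γ t (1 : ℝ))) =
        fun t => w t * timePairing S ι (rot e (p, s t)) (vert d e (rot e (p, s t))) :=
      funext fun t => by rw [hw t, timePairing_smul, hrot t]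
    rw [hfun] at h1
    refine h1.congr_deriv ?_
    rw [hw t, timeShear_smul, hrot t]
    have := hτ0 (s t)
    field_simp

end Holonomy

/-! ### Gluing local solutions over the base -/

section Gluing

variable {d k : ℕ} {H B : Type*} [TopologicalSpace H]
  [ChartedSpace (EuclideanSpace ℝ (Fin d)) H] [TopologicalSpace B]
  [T2Space B] [SecondCountableTopology B]
  [ChartedSpace (EuclideanSpace ℝ (Fin k)) B] [IsManifold (𝓡 k) ∞ B] {proj : H → B}

/-- Positive local solutions of the linear equation `X F = - κ F`, for a vertical field `X`, glue to
a global one. -/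
theorem exists_global_scaling {e : B → Bundle.Trivialization Circle proj}
    (he : ∀ b, IsSmoothTrivialization d k (e b)) (hb : ∀ b, b ∈ (e b).baseSet)
    {X : ∀ p : H, TangentSpace (𝓡 d) p} {κ : H → ℝ} {F : B → H → ℝ}
    (hX : ∀ p : H, ∃ a : ℝ, X p = a • vert d (e (proj p)) p)
    (hF : ∀ b, ContMDiffOn (𝓡 d) 𝓘(ℝ, ℝ) ∞ (F b) (e b).source)
    (hpos : ∀ b, ∀ p ∈ (e b).source, 0 < F b p)
    (heq : ∀ b, ∀ p ∈ (e b).source,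
      dirDeriv (F b) p (X p) = -(κ p * F b p)) :
    ∃ G : H → ℝ, ContMDiff (𝓡 d) 𝓘(ℝ, ℝ) ∞ G ∧ (∀ p, 0 < G p) ∧
      ∀ p, dirDeriv G p (X p) = -(κ p * G p) := by
  have : LocallyCompactSpace B := ChartedSpace.locallyCompactSpace (EuclideanSpace ℝ (Fin k)) B
  obtain ⟨ρ, hρ⟩ := SmoothPartitionOfUnity.exists_isSubordinate (𝓡 k) (isClosed_univ (X := B))
    (fun b => (e b).baseSet) (fun b => (e b).open_baseSet)
    (fun b _ => Set.mem_iUnion.2 ⟨b, hb b⟩)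
  have hproj : ContMDiff (𝓡 d) (𝓡 k) ∞ proj := fun p =>
    (he (proj p)).contMDiffOn_proj.contMDiffAt
      ((e (proj p)).open_source.mem_nhds ((e (proj p)).mem_source.2 (hb _)))
  have hρ0 : ∀ b p, ρ b (proj p) ≠ 0 → p ∈ (e b).source := fun b p h =>
    (e b).mem_source.2 (hρ b (subset_tsupport _ h))
  set G : H → ℝ := fun p => ∑ᶠ b, ρ b (proj p) * F b p with hG
  -- On the fibre through `p` the weights are constant, so `G` is one finite sum with fixed
  -- coefficients there and no derivative of `ρ` will appear.
  have hGsum : ∀ p q, proj q = proj p → G q = ∑ b ∈ ρ.finsupport (proj p),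
      ρ b (proj p) * F b q := by
    intro p q hq
    simp only [hG, hq]
    refine finsum_eq_sum_of_support_subset _ fun b hb => ?_
    rw [SmoothPartitionOfUnity.coe_finsupport]
    exact left_ne_zero_of_mul hb
  have hGs : ContMDiff (𝓡 d) 𝓘(ℝ, ℝ) ∞ G := by
    refine contMDiff_finsum (fun b => ?_) ?_
    · refine contMDiff_of_tsupport fun p hp => ?_
      have hpb : p ∈ (e b).source := by
        refine (e b).mem_source.2 (hρ b ?_)
        have h1 : tsupport (fun p => ρ b (proj p) * F b p) ⊆ tsupport (ρ b ∘ proj) :=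
          closure_mono fun q hq => left_ne_zero_of_mul hq
        exact tsupport_comp_subset_preimage (ρ b) hproj.continuous (h1 hp)
      exact (((ρ b).contMDiff.comp hproj).contMDiffAt).mul
        ((hF b).contMDiffAt ((e b).open_source.mem_nhds hpb))
    · exact (ρ.locallyFinite.preimage_continuous hproj.continuous).subset
        fun b p hp => left_ne_zero_of_mul hp
  refine ⟨G, hGs, fun p => ?_, fun p => ?_⟩
  · rw [hGsum p p rfl]
    have hnn : ∀ b, 0 ≤ ρ b (proj p) * F b p := fun b => by
      by_cases h : ρ b (proj p) = 0
      · simp [h]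
      · exact mul_nonneg (ρ.nonneg _ _) (hpos b p (hρ0 b p h)).le
    obtain ⟨b, hb'⟩ := ρ.exists_pos_of_mem (Set.mem_univ (proj p))
    refine Finset.sum_pos' (fun b _ => hnn b) ⟨b, ?_, ?_⟩
    · rw [SmoothPartitionOfUnity.mem_finsupport]; exact hb'.ne'
    · exact mul_pos hb' (hpos b p (hρ0 b p hb'.ne'))
  · obtain ⟨a, ha⟩ := hX p
    have hp : p ∈ (e (proj p)).source := (e (proj p)).mem_source.2 (hb _)
    have h1 := (he (proj p)).hasDerivAt_comp_rot hp (hGs.mdifferentiableAt (by simp) (x := p))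
    have hfd : ∀ b ∈ ρ.finsupport (proj p), MDifferentiableAt (𝓡 d) 𝓘(ℝ, ℝ) (F b) p := by
      intro b hb'
      rw [SmoothPartitionOfUnity.mem_finsupport] at hb'
      exact ((hF b).contMDiffAt ((e b).open_source.mem_nhds (hρ0 b p hb'))).mdifferentiableAt
        (by simp)
    have h2 := HasDerivAt.fun_sum (u := ρ.finsupport (proj p)) fun b hb' =>
      ((he (proj p)).hasDerivAt_comp_rot hp (hfd b hb')).const_mul (ρ b (proj p))
    have h3 : (fun s => G (rot (e (proj p)) (p, s))) = fun s => ∑ b ∈ ρ.finsupport (proj p),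
        ρ b (proj p) * F b (rot (e (proj p)) (p, s)) :=
      funext fun s => hGsum p _ (proj_rot hp s)
    rw [h3] at h1
    have h4 : dirDeriv G p (vert d (e (proj p)) p) = ∑ b ∈ ρ.finsupport (proj p),
      ρ b (proj p) * dirDeriv (F b) p (vert d (e (proj p)) p) := h1.unique h2
    have h5 : ∀ f : H → ℝ, dirDeriv f p (X p) =
        a * dirDeriv f p (vert d (e (proj p)) p) := fun f => by
      rw [ha, dirDeriv_smul]
    rw [h5, h4, hGsum p p rfl, Finset.mul_sum, Finset.mul_sum, ← Finset.sum_neg_distrib]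
    refine Finset.sum_congr rfl fun b hb' => ?_
    rw [SmoothPartitionOfUnity.mem_finsupport] at hb'
    have h6 := heq b p (hρ0 b p hb')
    rw [h5] at h6
    linear_combination (ρ b (proj p)) * h6

end Gluing

/-! ### Normalization by the time field and the surface gravity of a rescaled field -/

section Normalized

variable {d k : ℕ} {M : Type*} [TopologicalSpace M]
  [ChartedSpace (EuclideanSpace ℝ (Fin (d + 1))) M] [IsManifold (𝓡 (d + 1)) ∞ M]
  {H : Type*} [TopologicalSpace H] [ChartedSpace (EuclideanSpace ℝ (Fin d)) H]

/-- The multiple of `v` whose pairing with the time field is `-1`. -/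
noncomputable def timeNormalized (S : Spacetime d M) (ι : H → M) (p : H)
    (v : TangentSpace (𝓡 d) p) : TangentSpace (𝓡 d) p := (-(timePairing S ι p v)⁻¹) • v

variable {S : Spacetime d M} {D : Connection (d + 1) M} {ι : H → M} {p : H}

/-- Scale and sign both cancel, so the vertical fields of different trivializations, proportional to
one another, normalize to a single global field. -/
theorem timeNormalized_smul {c : ℝ} (hc : c ≠ 0) (v : TangentSpace (𝓡 d) p) :
    timeNormalized S ι p (c • v) = timeNormalized S ι p v := by
  simp only [timeNormalized, timePairing_smul, smul_smul]
  congr 1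
  field_simp

variable [IsManifold (𝓡 d) ∞ H]

/-- With `n = F X` one has `g(n, T) = -F`. Differentiating this along `n` gives `-F (X F) = -θ(n) F
+ F² σ(X)`, and the equation for `F` leaves `θ(n) F = 0`. -/
theorem IsRotationForm.eq_zero_of_scaling (hD : IsLeviCivita S D)
    (hι : ContMDiff (𝓡 d) (𝓡 (d + 1)) ∞ ι) {X : ∀ p : H, TangentSpace (𝓡 d) p} {F : H → ℝ}
    {θ : ∀ p : H, TangentSpace (𝓡 d) p →L[ℝ] ℝ}
    (hX : ∀ p, timePairing S ι p (X p) = -1)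
    (hn : ContMDiff (𝓡 d) (𝓡 d).tangent ∞
      (fun p => (⟨p, F p • X p⟩ : TangentBundle (𝓡 d) H)))
    (hF0 : ∀ p, F p ≠ 0) (hF : ContMDiff (𝓡 d) 𝓘(ℝ, ℝ) ∞ F)
    (heq : ∀ p, dirDeriv F p (X p) = -(timeShear S D ι p (X p) * F p))
    (hθ : IsRotationForm D ι (fun p => F p • X p) θ) (p : H) : θ p (F p • X p) = 0 := by
  have hpush : ContMDiff (𝓡 d) (𝓡 (d + 1)).tangent ∞ (fun p =>
      (⟨ι p, mfderiv (𝓡 d) (𝓡 (d + 1)) ι p (F p • X p)⟩ : TangentBundle (𝓡 (d + 1)) M)) :=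
    contMDiffOn_univ.1 (contMDiffOn_pushforward hι hn.contMDiffOn)
  have hmet := hD.hasMFDerivAt_metric_along (J := 𝓡 d) (hpush.mdifferentiableAt (by simp))
    (S.time_smooth.mdifferentiableAt (by simp)) (F p • X p) (p := p)
  change dirDeriv (fun q => S.g (ι q) (mfderiv (𝓡 d) (𝓡 (d + 1)) ι q (F q • X q))
    (S.time (ι q))) p (F p • X p) = _ at hmet
  have hfun : (fun q => S.g (ι q) (mfderiv (𝓡 d) (𝓡 (d + 1)) ι q (F q • X q)) (S.time (ι q))) =
      -F := by
    ext q
    have := timePairing_smul (S := S) (ι := ι) (F q) (X q)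
    rw [hX q, mul_neg_one] at this
    exact this
  have hcov : S.g (ι p) (covDerivAlong D (𝓡 d) ι
      (fun q => mfderiv (𝓡 d) (𝓡 (d + 1)) ι q (F q • X q)) p (F p • X p)) (S.time (ι p)) =
      θ p (F p • X p) * -F p := by
    rw [hθ p (F p • X p)]
    refine Eq.trans ?_ (congrArg (θ p (F p • X p) * ·) (congrFun hfun p))
    exact DFunLike.congr_fun (map_smul (S.g (ι p)) (θ p (F p • X p)) _) (S.time (ι p))
  have hneg : ∀ v : TangentSpace (𝓡 d) p, (dirDeriv (-F) p v : ℝ) =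
      -dirDeriv F p v := fun v =>
    DFunLike.congr_fun ((hF.mdifferentiableAt (by simp)).hasMFDerivAt.neg.mfderiv) v
  have h1 : dirDeriv F p (F p • X p) =
      F p * (-(timeShear S D ι p (X p) * F p)) := by
    rw [← heq p, dirDeriv_smul]
  have h3 : S.g (ι p) (mfderiv (𝓡 d) (𝓡 (d + 1)) ι p (F p • X p))
      (D S.time (ι p) (mfderiv (𝓡 d) (𝓡 (d + 1)) ι p (F p • X p))) =
      F p ^ 2 * timeShear S D ι p (X p) := timeShear_smul (S := S) (D := D) (ι := ι) (F p) (X p)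
  rw [hfun, hcov, hneg, h1, h3] at hmet
  have h4 : θ p (F p • X p) * F p = 0 := by linear_combination hmet
  exact (mul_eq_zero.1 h4).resolve_right (hF0 p)

end Normalized
end NullHorizon

/-! ### Construction of the field with zero surface gravity -/

theorem mainTheorem2 {k : ℕ}
    {M : Type*} [TopologicalSpace M] [T2Space M] [ParacompactSpace M]
    [ChartedSpace (EuclideanSpace ℝ (Fin (k + 1 + 1))) M] [IsManifold (𝓡 (k + 1 + 1)) ∞ M]
    (S : NullHorizon.Spacetime (k + 1) M) (D : NullHorizon.Connection (k + 1 + 1) M)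
    (hD : NullHorizon.IsLeviCivita S D)
    {H : Type*} [TopologicalSpace H] [ChartedSpace (EuclideanSpace ℝ (Fin (k + 1))) H]
    [IsManifold (𝓡 (k + 1)) ∞ H]
    (ι : H → M) (hH : NullHorizon.IsHorizon S D ι) (hdeg : NullHorizon.IsDegenerate S D ι)
    {B : Type*} [TopologicalSpace B] [T2Space B] [SecondCountableTopology B]
    [ChartedSpace (EuclideanSpace ℝ (Fin k)) B] [IsManifold (𝓡 k) ∞ B]
    (proj : H → B) (hproj : NullHorizon.IsSmoothCircleBundle (d := k + 1) (k := k) proj)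
    (hgen : ∀ b : B, NullHorizon.IsGenerator S ι (proj ⁻¹' {b})) :
    ∃ n : (∀ p : H, TangentSpace (𝓡 (k + 1)) p),
      NullHorizon.IsLightlikeField S ι n ∧
      NullHorizon.HasSurfaceGravity D ι n (fun _ => 0) := by
  open NullHorizon in
  choose e hb he1 he2 using hproj
  have he : ∀ b, IsSmoothTrivialization (k + 1) k (e b) := fun b => ⟨he1 b, he2 b⟩
  have hι : ContMDiff (𝓡 (k + 1)) (𝓡 (k + 1 + 1)) ∞ ι := hH.embedding.contMDiff
  have hinj : ∀ p, Function.Injective (mfderiv (𝓡 (k + 1)) (𝓡 (k + 1 + 1)) ι p) := fun p =>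
    injective_mfderiv_of_isImmersionAt (hH.embedding.isImmersion.isImmersionAt p)
  have hlight := fun (b : B) (p : H) (hp : p ∈ (e b).source) =>
    (he b).vert_lightlike hp (hgen (proj p))
  have hpair : ∀ b, ∀ p ∈ (e b).source, timePairing S ι p (vert (k + 1) (e b) p) ≠ 0 :=
    fun b p hp => timePairing_ne_zero (hinj p) (hlight b p hp).1 (hlight b p hp).2
  have hmem : ∀ p, p ∈ (e (proj p)).source := fun p => (e (proj p)).mem_source.2 (hb _)
  set X : ∀ p : H, TangentSpace (𝓡 (k + 1)) p := fun p =>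
    timeNormalized S ι p (vert (k + 1) (e (proj p)) p) with hXdef
  have hX : ∀ b, ∀ p ∈ (e b).source, X p = timeNormalized S ι p (vert (k + 1) (e b) p) := by
    intro b p hp
    obtain ⟨c, hc, hv⟩ := (he b).exists_vert_eq_smul_vert (he (proj p)) hp (hmem p) (hgen (proj p))
    simp only [hXdef]
    rw [hv, timeNormalized_smul hc]
  have hXpair : ∀ p, timePairing S ι p (X p) = -1 := fun p => by
    have := hpair _ p (hmem p)
    simp only [hXdef, timeNormalized, timePairing_smul]
    field_simp
  have hlocal : ∀ b, ∃ F : H → ℝ, ContMDiffOn (𝓡 (k + 1)) 𝓘(ℝ, ℝ) ∞ F (e b).source ∧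
      (∀ p ∈ (e b).source, 0 < F p) ∧ ∀ p ∈ (e b).source,
        dirDeriv F p (X p) = -(timeShear S D ι p (X p) * F p) := by
    intro b
    have hτ := contMDiffOn_timePairing (S := S) hι (he b).contMDiffOn_vert
    have hσ := contMDiffOn_timeShear hD hι (he b).contMDiffOn_vert
    -- The local equation is solved for the vertical field `V`, with `κ = -σ(V) / g(V, T)`.
    obtain ⟨F, hF, hFpos, hFeq⟩ := (he b).exists_scaling ((hσ.div₀ hτ (hpair b)).neg)
      fun p hp => (he b).integral_eq_zero_of_isCompleteGenerator hD hι (hpair b) hp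
        (hdeg _ (hgen (proj p)))
    refine ⟨F, hF, hFpos, fun p hp => ?_⟩
    have h0 := hpair b p hp
    -- Passing from `V` to `X = -V / g(V, T)` scales the derivative linearly and `σ` quadratically,
    -- which turns the equation for `V` into the one for `X`.
    rw [hX b p hp, timeNormalized, timeShear_smul, dirDeriv_smul, hFeq p hp]
    simp only [Pi.div_apply]
    field_simp
  choose F hF hFpos hFeq using hlocal
  obtain ⟨G, hG, hGpos, hGeq⟩ := exists_global_scaling (X := X)
    (κ := fun p => timeShear S D ι p (X p)) he hb (fun p => ⟨_, rfl⟩) hF hFpos hFeq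
  have hXs : ContMDiff (𝓡 (k + 1)) (𝓡 (k + 1)).tangent ∞
      (fun p => (⟨p, X p⟩ : TangentBundle (𝓡 (k + 1)) H)) := by
    intro p
    have hτ := contMDiffOn_timePairing (S := S) hι (he (proj p)).contMDiffOn_vert
    have h1 : ContMDiffOn (𝓡 (k + 1)) (𝓡 (k + 1)).tangent ∞
        (fun q => (⟨q, timeNormalized S ι q (vert (k + 1) (e (proj p)) q)⟩ :
          TangentBundle (𝓡 (k + 1)) H)) (e (proj p)).source :=
      ((hτ.inv₀ (hpair _)).neg).smul_section (he (proj p)).contMDiffOn_vert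
    refine (h1.congr fun q hq => ?_).contMDiffAt ((e (proj p)).open_source.mem_nhds (hmem p))
    rw [hX _ q hq]
  have hns : ContMDiff (𝓡 (k + 1)) (𝓡 (k + 1)).tangent ∞
      (fun p => (⟨p, G p • X p⟩ : TangentBundle (𝓡 (k + 1)) H)) := hG.smul_section hXs
  have hn : IsLightlikeField S ι fun p => G p • X p := by
    refine ⟨hns, fun p => ?_, fun p => ?_⟩
    · have := (hlight _ p (hmem p)).2
      simp only [inducedForm] at this
      simp only [inducedForm, hXdef, timeNormalized, map_smul, smul_apply, this, smul_zero]
    -- The normalization `g(X, T) = -1` fixes the time direction: the pairing of `n` with `T` is `-G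
    -- p < 0`.
    · have h1 := timePairing_smul (S := S) (ι := ι) (G p) (X p)
      rw [hXpair p, timePairing, S.g_symm] at h1
      rw [h1]
      linarith [hGpos p]
  obtain ⟨θ, hθ⟩ := hH.totally_geodesic _ hn
  exact ⟨_, hn, θ, hθ, fun p => (IsRotationForm.eq_zero_of_scaling hD hι hXpair hns
    (fun p => (hGpos p).ne') hG hGeq hθ p).symm⟩
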